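/- Let $V\subset(\mathbb C^*)^n$ be an algebraic variety (a Zariski closed subset, not necessarily irreducible) all of whose irreducible components have codimension $k$, and let $\mathcal A=\operatorname{Log}(V)\subset\mathbb R^n$ be its amoeba, where $\operatorname{Log}(z_1,\dots,z_n)=(\log|z_1|,\dots,\log|z_n|)$. An open round disk $D\subset L$ of radius $\delta>0$ in an affine $k$-plane $L\subset\mathbb R^n$ (that is, $D=\{x\in L: |x-c|<\delta\}$ for some $c\in L$) is called a supporting $k$-cap for $\mathcal A$ if (i) $D\cap\mathcal A$ is non-empty and compact, and (ii) there is a vector $v\in\mathbb R^n$ such that the translate $D+\varepsilon v$ is disjoint from $\mathcal A$ for all sufficiently small $\varepsilon>0$. Then $\mathcal A$ has no supporting $k$-caps. -/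

import Mathlib

open Set Filter Topology
open scoped Pointwise

namespace Amoeba

/-- The inclusion of the complex torus `(ℂ*)ⁿ` in `ℂⁿ`. -/
def torusIncl {n : ℕ} (z : Fin n → ℂˣ) : Fin n → ℂ := fun i => (z i : ℂ)

/-- `V ⊆ (ℂ*)ⁿ` is Zariski closed: the common zero set of a family of polynomials. (Equivalently, of
a family of Laurent polynomials: multiplying by a monomial does not change the zeros in `(ℂ*)ⁿ`.)
No irreducibility is required. -/
def IsAlgebraicSet {n : ℕ} (V : Set (Fin n → ℂˣ)) : Prop :=
  ∃ S : Set (MvPolynomial (Fin n) ℂ),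
    V = {z | ∀ p ∈ S, MvPolynomial.eval (torusIncl z) p = 0}

/-- `V ⊆ (ℂ*)ⁿ` has codimension `k`, i.e. each of its irreducible components has codimension `k`.
The minimal primes of the ideal of all polynomials vanishing on `V` are the ideals of the
irreducible components of `V` (equivalently, of its closure in `ℂⁿ`), and the codimension of an
irreducible variety is the height of its prime ideal. -/
def HasCodim {n : ℕ} (V : Set (Fin n → ℂˣ)) (k : ℕ) : Prop :=
  ∀ P ∈ (MvPolynomial.vanishingIdeal ℂ (torusIncl '' V)).minimalPrimes, P.height = k

/-- `Log (z₁, …, zₙ) = (log |z₁|, …, log |zₙ|)`. -/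
noncomputable def Log {n : ℕ} (z : Fin n → ℂˣ) : EuclideanSpace ℝ (Fin n) :=
  WithLp.toLp 2 fun i => Real.log ‖(z i : ℂ)‖

/-- The amoeba of `V`. -/
def amoeba {n : ℕ} (V : Set (Fin n → ℂˣ)) : Set (EuclideanSpace ℝ (Fin n)) := Log '' V

/-- `D` is an open round disk, of some radius `δ > 0`, in some affine `k`-plane `L ⊆ ℝⁿ`. -/
def IsOpenDisk {n : ℕ} (k : ℕ) (D : Set (EuclideanSpace ℝ (Fin n))) : Prop :=
  ∃ L : AffineSubspace ℝ (EuclideanSpace ℝ (Fin n)), Module.finrank ℝ L.direction = k ∧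
    ∃ c ∈ L, ∃ δ : ℝ, 0 < δ ∧ D = Metric.ball c δ ∩ (L : Set (EuclideanSpace ℝ (Fin n)))

/-- `D` is a supporting `k`-cap for `A`. -/
def IsSupportingCap {n : ℕ} (k : ℕ) (A D : Set (EuclideanSpace ℝ (Fin n))) : Prop :=
  IsOpenDisk k D ∧ (D ∩ A).Nonempty ∧ IsCompact (D ∩ A) ∧
    ∃ v : EuclideanSpace ℝ (Fin n), ∀ᶠ ε : ℝ in 𝓝[>] 0, Disjoint ((ε • v) +ᵥ D) A

end Amoeba

/-! Suppose a cap touches the amoeba at `x₀`. Together with the component of `v` orthogonal to the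
disk, the disk spans a `(k+1)`-plane. A large ball centred far below the disk cuts off a thin lens
in that plane. The lens is swept out by a slightly smaller disk and the translates that miss the
amoeba, so the amoeba avoids the spherical side of the lens, although `x₀` lies on its flat side
(`Amoeba.IsSupportingCap.exists_lens`). `Log` is proper on a closed subvariety of the torus, so the
part of the amoeba on the sphere is compact. The plane and the half-space can therefore be tilted
about `x₀` to have integral coefficients (`exists_int_forall_of_isCompact`).

An integral linear form in `Log` is the logarithm of the modulus of a Laurent monomial. The
equations of the rational plane follow from `s < n - k` binomial equations. By dimension theory
these leave a positive-dimensional irreducible variety `Z` through `w₀`, a point over `x₀`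
(`MvPolynomial.exists_isPrime_lt_of_card_add_height_lt`). The points of `Z` over the lens form a
compact set `K`. A maximum on `K` of the monomial defining the half-space is a local maximum on `Z`:
the spherical side is excluded, and increasing the monomial stays in the half-space. The maximum
principle makes this monomial constant, so the half-space condition becomes vacuous. Each coordinate
then attains its maximum modulus on `K` as a local maximum on `Z`, so it is constant too and `Z` is
a point, a contradiction (`exists_logNorm_mem_sphere_of_add_height_lt`).

The maximum principle on a possibly singular variety (`MvPolynomial.frequently_norm_div_lt`) follows
from openness of nonconstant regular functions
(`Algebra.FiniteType.eventually_exists_forall_norm_sub_lt`). That is proved by cutting down to a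
curve, applying Zariski's main theorem, and using continuity of roots. -/

/-! ### Heights of primes in polynomial rings over a field. -/

section Dimension

variable {k : Type*} [Field k]

/-- Maximal ideals of a polynomial ring in `n` variables over a field have height at least `n`. -/
theorem MvPolynomial.le_height_of_isMaximal (n : ℕ) (M : Ideal (MvPolynomial (Fin n) k))
    [hM : M.IsMaximal] : (n : ℕ∞) ≤ M.height := by
  induction n with
  | zero => simp
  | succ n ih =>
    let e := (MvPolynomial.finSuccEquiv k n).toRingEquiv
    have hN : (M.map e).IsMaximal := Ideal.map_isMaximal_of_equiv e
    -- Polynomial rings over a field are Jacobson, so the contraction to one variable fewer is again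
    -- maximal; the height drops by exactly one.
    have hp : ((M.map e).under (MvPolynomial (Fin n) k)).IsMaximal :=
      Polynomial.isMaximal_comap_C_of_isJacobsonRing _
    have hl : (M.map e).LiesOver ((M.map e).under (MvPolynomial (Fin n) k)) := ⟨rfl⟩
    rw [← e.height_map M,
      Polynomial.height_eq_height_add_one ((M.map e).under (MvPolynomial (Fin n) k)) (M.map e)]
    push_cast
    gcongr
    exact ih _

/-- A maximal ideal of an integral domain which is an integral extension of a polynomial ring
in `d` variables has height at least `d`. -/
theorem Ideal.le_height_of_isMaximal_of_isIntegral (d : ℕ) {A : Type*} [CommRing A] [IsDomain A]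
    [IsNoetherianRing A] [Algebra (MvPolynomial (Fin d) k) A]
    [Algebra.IsIntegral (MvPolynomial (Fin d) k) A] [FaithfulSMul (MvPolynomial (Fin d) k) A]
    (M : Ideal A) [M.IsMaximal] : (d : ℕ∞) ≤ M.height := by
  have hm : (M.under (MvPolynomial (Fin d) k)).IsMaximal :=
    Ideal.isMaximal_comap_of_isIntegral_of_isMaximal M
  -- Going down is available because the polynomial ring is integrally closed.
  rw [Ideal.height_eq_height_add_of_liesOver_of_hasGoingDown
    (M.under (MvPolynomial (Fin d) k)) M]
  exact (MvPolynomial.le_height_of_isMaximal d _).trans le_self_add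

/-- The kernel of an evaluation `Y[X₁, …, Xₙ] → A` with values in an algebraic extension `A` of the
domain `Y` has height at least `n`. -/
theorem MvPolynomial.le_height_ker_aeval {Y A : Type*} [CommRing Y] [IsDomain Y] [CommRing A]
    [IsDomain A] [Algebra Y A] [FaithfulSMul Y A] [Algebra.IsAlgebraic Y A] (n : ℕ)
    (z : Fin n → A) :
    (n : ℕ∞) ≤ (RingHom.ker (MvPolynomial.aeval z : MvPolynomial (Fin n) Y →ₐ[Y] A)).height := by
  have : FaithfulSMul Y (FractionRing A) := (faithfulSMul_iff_algebraMap_injective _ _).2 <| by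
    rw [IsScalarTower.algebraMap_eq Y A (FractionRing A)]
    exact (IsFractionRing.injective A (FractionRing A)).comp
      (FaithfulSMul.algebraMap_injective Y A)
  let _ : Algebra (FractionRing Y) (FractionRing A) := FractionRing.liftAlgebra Y (FractionRing A)
  have : Algebra.IsAlgebraic A (FractionRing A) :=
    IsLocalization.isAlgebraic _ (nonZeroDivisors A)
  have : Algebra.IsAlgebraic (FractionRing Y) (FractionRing A) :=
    (IsFractionRing.comap_isAlgebraic_iff (A := Y)).1 (Algebra.IsAlgebraic.trans Y A _)
  -- Over the fraction field of `Y` the image of the evaluation is algebraic over a field, hence a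
  -- field, so the kernel is maximal. Localization preserves the height of its contraction.
  let ψ : MvPolynomial (Fin n) (FractionRing Y) →ₐ[FractionRing Y] FractionRing A :=
    MvPolynomial.aeval fun i => algebraMap A _ (z i)
  have hψ : (RingHom.ker ψ).IsMaximal := by
    have h := Subalgebra.isField_of_algebraic ψ.range
    let _ : Field ψ.range := h.toField
    rw [← AlgHom.ker_rangeRestrict ψ]
    exact RingHom.ker_isMaximal_of_surjective _ ψ.rangeRestrict_surjective
  let _ : Algebra (MvPolynomial (Fin n) Y) (MvPolynomial (Fin n) (FractionRing Y)) :=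
    (MvPolynomial.map (algebraMap Y (FractionRing Y))).toAlgebra
  have : IsLocalization (Submonoid.map (MvPolynomial.C (σ := Fin n)) (nonZeroDivisors Y))
      (MvPolynomial (Fin n) (FractionRing Y)) := MvPolynomial.isLocalization _ _
  have hQ : (RingHom.ker ψ).under (MvPolynomial (Fin n) Y) =
      RingHom.ker (MvPolynomial.aeval z : MvPolynomial (Fin n) Y →ₐ[Y] A) := by
    ext e
    change ψ (MvPolynomial.map (algebraMap Y (FractionRing Y)) e) = 0 ↔ MvPolynomial.aeval z e = 0
    rw [← (IsFractionRing.injective A (FractionRing A)).eq_iff, map_zero]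
    have : (ψ : _ →+* _).comp (MvPolynomial.map (algebraMap Y (FractionRing Y))) =
        (algebraMap A (FractionRing A)).comp
          (MvPolynomial.aeval z : MvPolynomial (Fin n) Y →ₐ[Y] A).toRingHom := by
      apply MvPolynomial.ringHom_ext
      · intro y
        simp only [RingHom.comp_apply, MvPolynomial.map_C, RingHom.coe_coe,
          AlgHom.toRingHom_eq_coe, MvPolynomial.algHom_C]
        rw [← IsScalarTower.algebraMap_apply, ← IsScalarTower.algebraMap_apply]
      · intro i
        simp [ψ]
    rw [show ψ (MvPolynomial.map (algebraMap Y (FractionRing Y)) e) = _ from congr($this e)]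
    rfl
  rw [← hQ, IsLocalization.height_under
    (Submonoid.map (MvPolynomial.C (σ := Fin n)) (nonZeroDivisors Y))]
  exact MvPolynomial.le_height_of_isMaximal n _

/-- Substituting polynomials `φ i` for the variables `y₁, …, y_d` lowers the height of a prime
ideal by at most `d`. -/
theorem MvPolynomial.height_comap_eval₂Hom_le (n d : ℕ) (P : Ideal (MvPolynomial (Fin n) k))
    [P.IsPrime] (φ : Fin d → MvPolynomial (Fin n) k) :
    (P.comap (eval₂Hom (aeval φ : MvPolynomial (Fin d) k →ₐ[k] _).toRingHom X)).height ≤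
      P.height + d := by
  classical
  set σ : MvPolynomial (Fin n) (MvPolynomial (Fin d) k) →+* MvPolynomial (Fin n) k :=
    eval₂Hom (aeval φ : MvPolynomial (Fin d) k →ₐ[k] _).toRingHom X with σ_def
  have σC (y) : σ (C y) = aeval φ y := eval₂Hom_C _ _ _
  have σX (i) : σ (X i) = X i := eval₂Hom_X' _ _ _
  clear_value σ
  set ι : MvPolynomial (Fin n) k →+* MvPolynomial (Fin n) (MvPolynomial (Fin d) k) :=
    map C with ι_def
  have ιC (r) : ι (C r) = C (C r) := map_C _ _
  have ιX (i) : ι (X i) = X i := map_X _ _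
  clear_value ι
  have hσ : ∀ p, σ (ι p) = p := by
    intro p
    have : σ.comp ι = RingHom.id _ := by
      apply MvPolynomial.ringHom_ext
      · intro r
        simp [σC, ιC]
      · intro i
        simp [σX, ιX]
    exact congr($this p)
  let _ : Algebra (MvPolynomial (Fin n) k) (MvPolynomial (Fin n) (MvPolynomial (Fin d) k)) :=
    ι.toAlgebra
  have hQ : (P.comap σ).IsPrime := Ideal.IsPrime.comap σ
  set Q := P.comap σ
  have hlo : Q.LiesOver P := ⟨by
    ext p
    change p ∈ P ↔ σ (ι p) ∈ P
    rw [hσ]⟩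
  let J : Ideal (MvPolynomial (Fin n) (MvPolynomial (Fin d) k)) :=
    Ideal.span (Set.range fun i => C (X i) - ι (φ i))
  have hJ : ∀ e, e - ι (σ e) ∈ J := by
    intro e
    rw [← Ideal.Quotient.eq]
    have : Ideal.Quotient.mk J = ((Ideal.Quotient.mk J).comp ι).comp σ := by
      apply MvPolynomial.ringHom_ext
      · intro y
        have : (Ideal.Quotient.mk J).comp C = (((Ideal.Quotient.mk J).comp ι).comp σ).comp C := by
          apply MvPolynomial.ringHom_ext
          · intro r
            simp only [RingHom.comp_apply, σC, algHom_C, algebraMap_eq, ιC]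
          · intro i
            simp only [RingHom.comp_apply, σC, aeval_X]
            rw [Ideal.Quotient.eq]
            exact Ideal.subset_span ⟨i, rfl⟩
        exact congr($this y)
      · intro i
        simp only [RingHom.comp_apply, σX, ιX]
    exact congr($this e)
  -- Modulo the extension of `P`, the prime `Q` is generated by the `d` elements `y i - φ i`, so
  -- Krull's height theorem bounds the second summand.
  refine (Ideal.height_le_height_add_of_liesOver P Q).trans ?_
  gcongr
  set mk := Ideal.Quotient.mk
    (P.map (algebraMap _ (MvPolynomial (Fin n) (MvPolynomial (Fin d) k))))
  have hle : P.map (algebraMap _ (MvPolynomial (Fin n) (MvPolynomial (Fin d) k))) ≤ Q := by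
    rw [Ideal.map_le_iff_le_comap]
    exact hlo.over.le
  have hQm : (Q.map mk).IsPrime := Ideal.isPrime_map_quotientMk_of_isPrime hle
  have hspan : Q.map mk = Ideal.span
      (Finset.univ.image fun i => mk (C (X i) - ι (φ i)) : Finset _) := by
    apply le_antisymm
    · rw [Ideal.map_le_iff_le_comap]
      intro e he
      have h3 : mk (ι (σ e)) = 0 :=
        Ideal.Quotient.eq_zero_iff_mem.2 (Ideal.mem_map_of_mem _ he)
      have h4 : mk e = mk (e - ι (σ e)) := by rw [map_sub, h3, sub_zero]
      rw [Ideal.mem_comap, h4]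
      have h5 := Ideal.mem_map_of_mem mk (hJ e)
      rw [Ideal.map_span, ← Set.range_comp] at h5
      simpa only [Function.comp_def, Finset.coe_image, Finset.coe_univ, Set.image_univ] using h5
    · rw [Ideal.span_le]
      intro x hx
      simp only [Finset.coe_image, Finset.coe_univ, Set.image_univ, Set.mem_range] at hx
      obtain ⟨i, rfl⟩ := hx
      apply Ideal.mem_map_of_mem
      change σ _ ∈ P
      rw [map_sub, hσ, σC, aeval_X, sub_self]
      exact P.zero_mem
  have := Ideal.height_le_card_of_mem_minimalPrimes_span_finset (p := Q.map mk)
    (s := Finset.univ.image fun i => mk (C (X i) - ι (φ i)))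
    (by rw [← hspan, Ideal.minimalPrimes_eq_subsingleton_self]; rfl)
  refine this.trans ?_
  exact_mod_cast Finset.card_image_le.trans (by simp)

/-- If the quotient of the polynomial ring in `n` variables by a prime `P` is an integral extension
of a polynomial ring in `d` variables, then `P` has height at least `n - d`. -/
theorem MvPolynomial.le_height_add_of_isIntegral (n d : ℕ) (P : Ideal (MvPolynomial (Fin n) k))
    [P.IsPrime] (g : MvPolynomial (Fin d) k →ₐ[k] MvPolynomial (Fin n) k ⧸ P)
    (hg : Function.Injective g) (hi : g.IsIntegral) : (n : ℕ∞) ≤ P.height + d := by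
  -- Evaluation of `k[y][X]` in the quotient by `P` has kernel of height at least `n`. With `φ i`
  -- lifting `g (X i)`, this kernel is the preimage of `P` under `y i ↦ φ i`.
  choose φ hφ using fun i : Fin d => Ideal.Quotient.mk_surjective (I := P) (g (X i))
  refine le_trans ?_ (MvPolynomial.height_comap_eval₂Hom_le n d P φ)
  let _ : Algebra (MvPolynomial (Fin d) k) (MvPolynomial (Fin n) k ⧸ P) := g.toRingHom.toAlgebra
  have : Algebra.IsIntegral (MvPolynomial (Fin d) k) (MvPolynomial (Fin n) k ⧸ P) := ⟨hi⟩
  have : FaithfulSMul (MvPolynomial (Fin d) k) (MvPolynomial (Fin n) k ⧸ P) :=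
    (faithfulSMul_iff_algebraMap_injective _ _).2 hg
  have h := MvPolynomial.le_height_ker_aeval (Y := MvPolynomial (Fin d) k) n
    (fun i => Ideal.Quotient.mk P (X i))
  refine h.trans (le_of_eq (congrArg Ideal.height ?_))
  ext e
  rw [Ideal.mem_comap, RingHom.mem_ker, ← Ideal.Quotient.eq_zero_iff_mem]
  have : (Ideal.Quotient.mk P).comp (eval₂Hom (aeval φ : MvPolynomial (Fin d) k →ₐ[k] _).toRingHom X)
      = (aeval fun i => Ideal.Quotient.mk P (X i) :
        MvPolynomial (Fin n) (MvPolynomial (Fin d) k) →ₐ[MvPolynomial (Fin d) k] _).toRingHom := by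
    apply MvPolynomial.ringHom_ext
    · intro y
      have : ((Ideal.Quotient.mkₐ k P).comp (aeval φ)) = g := by
        apply MvPolynomial.algHom_ext
        intro i
        simp [hφ]
      have h1 : Ideal.Quotient.mk P (aeval φ y) = g y := congr($this y)
      simp only [RingHom.comp_apply, eval₂Hom_C, AlgHom.toRingHom_eq_coe, RingHom.coe_coe,
        algHom_C]
      exact h1
    · intro i
      simp
  exact (iff_of_eq (congrArg (· = 0) congr($this e))).symm

/-- Krull's height theorem relative to a prime of a polynomial ring: fewer than `n - ht P`
hypersurfaces do not cut the variety of `P` down to a point. -/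
theorem MvPolynomial.exists_isPrime_lt_of_card_add_height_lt (n : ℕ)
    (P M : Ideal (MvPolynomial (Fin n) k)) [P.IsPrime] [M.IsMaximal] (hPM : P ≤ M)
    (s : Finset (MvPolynomial (Fin n) k)) (hs : ∀ f ∈ s, f ∈ M)
    (hcard : (s.card : ℕ∞) + P.height < n) :
    ∃ P' : Ideal (MvPolynomial (Fin n) k), P'.IsPrime ∧ P ≤ P' ∧ P' < M ∧ ∀ f ∈ s, f ∈ P' := by
  classical
  -- Noether normalization: `n ≤ P.height + d`, and `M` has height at least `d` modulo `P`. Since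
  -- `s.card < d`, Krull prevents `M` from being minimal over the equations in `s`.
  obtain ⟨d, -, g, hg, hi⟩ :=
    exists_integral_inj_algHom_of_quotient P (Ideal.IsPrime.ne_top ‹_›)
  have hd := MvPolynomial.le_height_add_of_isIntegral n d P g hg hi
  let _ : Algebra (MvPolynomial (Fin d) k) (MvPolynomial (Fin n) k ⧸ P) := g.toRingHom.toAlgebra
  have : Algebra.IsIntegral (MvPolynomial (Fin d) k) (MvPolynomial (Fin n) k ⧸ P) := ⟨hi⟩
  have : FaithfulSMul (MvPolynomial (Fin d) k) (MvPolynomial (Fin n) k ⧸ P) :=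
    (faithfulSMul_iff_algebraMap_injective _ _).2 hg
  set mk := Ideal.Quotient.mk P
  have hM : (M.map mk).IsMaximal :=
    Ideal.IsMaximal.map_of_surjective_of_ker_le Ideal.Quotient.mk_surjective
      (by rwa [Ideal.mk_ker])
  have hdM := Ideal.le_height_of_isMaximal_of_isIntegral (k := k) d (M.map mk)
  have hcomap : (M.map mk).comap mk = M := Ideal.comap_map_mk hPM
  have hle : Ideal.span (s.image mk : Finset _) ≤ M.map mk := by
    rw [Ideal.span_le]
    intro x hx
    obtain ⟨f, hf, rfl⟩ := Finset.mem_image.1 hx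
    exact Ideal.mem_map_of_mem _ (hs f hf)
  obtain ⟨N, hN, hNM⟩ := Ideal.exists_minimalPrimes_le hle
  have hNp : N.IsPrime := hN.1.1
  refine ⟨N.comap mk, Ideal.IsPrime.comap mk, ?_, ?_, ?_⟩
  · intro p hp
    rw [Ideal.mem_comap, Ideal.Quotient.eq_zero_iff_mem.2 hp]
    exact N.zero_mem
  · refine lt_of_le_of_ne ((Ideal.comap_mono hNM).trans hcomap.le) fun h => ?_
    have h1 : N = M.map mk := by
      rw [← h, Ideal.map_comap_of_surjective mk Ideal.Quotient.mk_surjective]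
    have h2 := Ideal.height_le_card_of_mem_minimalPrimes_span_finset hN
    rw [h1] at h2
    have h3 : (d : ℕ∞) ≤ s.card :=
      (hdM.trans h2).trans (by exact_mod_cast Finset.card_image_le)
    have h4 : (n : ℕ∞) ≤ s.card + P.height := by
      rw [add_comm]
      exact hd.trans (by gcongr)
    exact absurd hcard (not_lt.2 h4)
  · intro f hf
    exact hN.1.2 (Ideal.subset_span (Finset.mem_coe.2 (Finset.mem_image_of_mem _ hf)))

end Dimension

/-! ### Lifting complex points along integral extensions. -/

section Extension

open Polynomial

/-- A ring homomorphism to an algebraically closed field extends along an integral extension. -/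
theorem Algebra.IsIntegral.exists_ringHom_comp_eq {R S K : Type*} [CommRing R] [CommRing S]
    [Field K] [IsAlgClosed K] [Algebra R S] [Algebra.IsIntegral R S] [FaithfulSMul R S]
    (f : R →+* K) (hf : Function.Surjective f) : ∃ g : S →+* K, g.comp (algebraMap R S) = f := by
  have hM : (RingHom.ker f).IsMaximal := RingHom.ker_isMaximal_of_surjective f hf
  -- The residue field of a maximal ideal over `ker f` is integral over the algebraically closed
  -- field `K`, hence equal to it.
  obtain ⟨N, hN, hNf⟩ := Ideal.exists_ideal_over_maximal_of_isIntegral (S := S) (RingHom.ker f)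
    (by rw [(RingHom.injective_iff_ker_eq_bot _).1 (FaithfulSMul.algebraMap_injective R S)]
        exact bot_le)
  let e := RingHom.quotientKerEquivOfSurjective hf
  let h : R ⧸ RingHom.ker f →+* S ⧸ N := Ideal.quotientMap N (algebraMap R S) hNf.ge
  let _ : Field (S ⧸ N) := Ideal.Quotient.field N
  let _ : Algebra K (S ⧸ N) := (h.comp e.symm.toRingHom).toAlgebra
  have hmap : ∀ r : R, algebraMap K (S ⧸ N) (f r) = Ideal.Quotient.mk N (algebraMap R S r) := by
    intro r
    change h (e.symm (f r)) = _
    have : e.symm (f r) = Ideal.Quotient.mk _ r := by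
      rw [RingEquiv.symm_apply_eq]
      rfl
    rw [this]
    rfl
  have hint : Algebra.IsIntegral K (S ⧸ N) := by
    refine ⟨fun x => ?_⟩
    obtain ⟨s, rfl⟩ := Ideal.Quotient.mk_surjective x
    obtain ⟨p, hp, hps⟩ := Algebra.IsIntegral.isIntegral (R := R) s
    refine ⟨p.map f, hp.map f, ?_⟩
    rw [Polynomial.eval₂_map]
    have : (algebraMap K (S ⧸ N)).comp f = (Ideal.Quotient.mk N).comp (algebraMap R S) :=
      RingHom.ext hmap
    rw [this, ← Polynomial.hom_eval₂, hps, map_zero]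
  let E := RingEquiv.ofBijective (algebraMap K (S ⧸ N))
    IsAlgClosed.algebraMap_bijective_of_isIntegral
  refine ⟨E.symm.toRingHom.comp (Ideal.Quotient.mk N), RingHom.ext fun r => ?_⟩
  change E.symm (Ideal.Quotient.mk N (algebraMap R S r)) = f r
  rw [RingEquiv.symm_apply_eq, ← hmap]
  rfl

/-- If `t` is a root of the specialised minimal polynomial of `u`, then there is a point of the
integral extension `S` of `R` lying over the given point of `R` at which `u` takes the value `t`. -/
theorem Algebra.IsIntegral.exists_ringHom_of_isRoot_minpoly {R S K : Type*} [CommRing R]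
    [IsDomain R] [IsIntegrallyClosed R] [CommRing S] [IsDomain S] [Field K] [IsAlgClosed K]
    [Algebra R S] [Algebra.IsIntegral R S] [FaithfulSMul R S] (f : R →+* K)
    (hf : Function.Surjective f) (u : S) (t : K) (ht : (minpoly R u).eval₂ f t = 0) :
    ∃ g : S →+* K, g.comp (algebraMap R S) = f ∧ g u = t := by
  have hu : IsIntegral R u := Algebra.IsIntegral.isIntegral u
  -- As `R` is integrally closed, `R[u]` is `R[T]` modulo the minimal polynomial, so any root `t`
  -- defines a point of `R[u]`; that point then lifts to `S`.
  let e := minpoly.equivAdjoin hu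
  let l : AdjoinRoot (minpoly R u) →+* K := AdjoinRoot.lift f t ht
  let f' : Algebra.adjoin R {u} →+* K := l.comp e.symm.toRingEquiv.toRingHom
  have hfR : ∀ r, f' (algebraMap R _ r) = f r := by
    intro r
    change l (e.symm (algebraMap R _ r)) = _
    rw [e.symm.commutes]
    exact AdjoinRoot.lift_of ht
  have : Algebra.IsIntegral (Algebra.adjoin R {u}) S := Algebra.IsIntegral.tower_top R
  obtain ⟨g, hg⟩ := Algebra.IsIntegral.exists_ringHom_comp_eq (S := S) f' fun y => by
    obtain ⟨r, rfl⟩ := hf y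
    exact ⟨_, hfR r⟩
  refine ⟨g, RingHom.ext fun r => ?_, ?_⟩
  · rw [← hfR r, ← hg]
    rfl
  · have h1 : g u = f' ⟨u, Algebra.self_mem_adjoin_singleton R u⟩ := by
      rw [← hg]
      rfl
    rw [h1]
    change l (e.symm _) = t
    have h2 : e.symm ⟨u, Algebra.self_mem_adjoin_singleton R u⟩ = AdjoinRoot.root _ := by
      rw [AlgEquiv.symm_apply_eq]
      ext
      simp [e]
    rw [h2]
    exact AdjoinRoot.lift_root ht

end Extension

/-! ### Continuity of points in integral covers of the line. -/

section OpenMapping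

open Polynomial

/-- If the value of a monic complex polynomial at `t` is small, then it has a root close to `t`. -/
theorem Polynomial.Monic.exists_isRoot_norm_sub_lt {p : ℂ[X]} (hp : p.Monic) {t : ℂ} {ε : ℝ}
    (hε : 0 < ε) (h : ‖p.eval t‖ < ε ^ p.natDegree) : ∃ r, p.IsRoot r ∧ ‖t - r‖ < ε := by
  by_contra! hc
  have hs := IsAlgClosed.splits p
  rw [hs.eval_eq_prod_roots, hp.leadingCoeff, one_mul, hs.natDegree_eq_card_roots] at h
  refine absurd h (not_lt.2 ?_)
  have : ∀ s : Multiset ℂ, (∀ r ∈ s, ε ≤ ‖t - r‖) →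
      ε ^ s.card ≤ ‖(s.map fun r => t - r).prod‖ := by
    intro s
    induction s using Multiset.induction_on with
    | empty => simp
    | cons a s ih =>
      intro hs
      rw [Multiset.card_cons, Multiset.map_cons, Multiset.prod_cons, norm_mul, pow_succ, mul_comm]
      have h1 := hs a (Multiset.mem_cons_self a s)
      have h2 := ih fun r hr => hs r (Multiset.mem_cons_of_mem hr)
      gcongr
  exact this _ fun r hr => hc r (Polynomial.isRoot_of_mem_roots hr)

/-- An integral extension of `ℂ[X]` has points over every point of the line close to a given one,
at which a given element takes values close to the given one. -/
theorem Algebra.IsIntegral.eventually_exists_norm_sub_lt {S : Type*} [CommRing S] [IsDomain S]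
    [Algebra ℂ[X] S] [Algebra.IsIntegral ℂ[X] S] [FaithfulSMul ℂ[X] S] (x : S →+* ℂ) (c₀ : ℂ)
    (hx : x.comp (algebraMap ℂ[X] S) = evalRingHom c₀) (u : S) {ε : ℝ} (hε : 0 < ε) :
    ∀ᶠ c in 𝓝 c₀, ∃ y : S →+* ℂ, y.comp (algebraMap ℂ[X] S) = evalRingHom c ∧
      ‖y u - x u‖ < ε := by
  set M := minpoly ℂ[X] u with hM
  have hmonic : M.Monic := minpoly.monic (Algebra.IsIntegral.isIntegral u)
  have h0 : ((M.map (evalRingHom c₀)).eval (x u)) = 0 := by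
    rw [Polynomial.eval_map, ← hx, ← Polynomial.hom_eval₂, ← Polynomial.aeval_def,
      minpoly.aeval, map_zero]
  have hcont : Continuous fun c => (M.map (evalRingHom c)).eval (x u) := by
    simp only [Polynomial.eval_map, Polynomial.eval₂_eq_sum_range, coe_evalRingHom]
    fun_prop
  have hev : ∀ᶠ c in 𝓝 c₀, ‖(M.map (evalRingHom c)).eval (x u)‖ < ε ^ M.natDegree := by
    have := hcont.norm.tendsto c₀
    rw [h0, _root_.norm_zero] at this
    exact this.eventually_lt_const (by positivity)
  filter_upwards [hev] with c hc
  have hdeg : (M.map (evalRingHom c)).natDegree = M.natDegree := hmonic.natDegree_map _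
  rw [← hdeg] at hc
  obtain ⟨t, ht, htu⟩ := (hmonic.map (evalRingHom c)).exists_isRoot_norm_sub_lt hε hc
  obtain ⟨y, hy, hyu⟩ := Algebra.IsIntegral.exists_ringHom_of_isRoot_minpoly (evalRingHom c)
    (fun z => ⟨C z, by simp⟩) u t (by rw [← Polynomial.eval_map]; exact ht)
  exact ⟨y, hy, by rw [hyu, norm_sub_rev]; exact htu⟩

/-- A bound for the roots of a monic polynomial. -/
theorem Polynomial.Monic.norm_le_of_isRoot {p : ℂ[X]} (hp : p.Monic) {t : ℂ} (h : p.IsRoot t) :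
    ‖t‖ ≤ 1 + ∑ k ∈ Finset.range p.natDegree, ‖p.coeff k‖ := by
  have h1 := h.norm_lt_cauchyBound hp.ne_zero
  have h2 : p.cauchyBound ≤ 1 + ∑ k ∈ Finset.range p.natDegree, ‖p.coeff k‖₊ := by
    rw [Polynomial.cauchyBound, hp.leadingCoeff, nnnorm_one, div_one, add_comm]
    gcongr
    refine Finset.sup_le fun k hk => ?_
    exact Finset.single_le_sum (f := fun k => ‖p.coeff k‖₊) (fun _ _ => zero_le) hk
  have h3 : (p.cauchyBound : ℝ) ≤ 1 + ∑ k ∈ Finset.range p.natDegree, ‖p.coeff k‖ := by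
    simpa using NNReal.coe_le_coe.2 h2
  exact (le_of_lt (by exact_mod_cast h1)).trans h3

/-- The version for finitely many elements. -/
theorem Algebra.IsIntegral.eventually_exists_forall_norm_sub_lt {S : Type*} [CommRing S]
    [IsDomain S] [Algebra ℂ[X] S] [Algebra.IsIntegral ℂ[X] S] [FaithfulSMul ℂ[X] S]
    (x : S →+* ℂ) (c₀ : ℂ) (hx : x.comp (algebraMap ℂ[X] S) = evalRingHom c₀)
    {ι : Type*} [Finite ι] (s : ι → S) {ε : ℝ} (hε : 0 < ε) :
    ∀ᶠ c in 𝓝 c₀, ∃ y : S →+* ℂ, y.comp (algebraMap ℂ[X] S) = evalRingHom c ∧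
      ∀ i, ‖y (s i) - x (s i)‖ < ε := by
  classical
  have := Fintype.ofFinite ι
  rcases isEmpty_or_nonempty ι with hι | hι
  · filter_upwards [Algebra.IsIntegral.eventually_exists_norm_sub_lt x c₀ hx 0 one_pos]
      with c ⟨y, hy, _⟩
    exact ⟨y, hy, fun i => hι.elim i⟩
  -- Over `c₀` the tuple of values has finitely many candidates. One element `u` is built to vanish
  -- at all candidates except `a₀`. Along an ultrafilter of bad parameters, points with `u` near `x
  -- u` have bounded values, so these converge to a candidate, which must be `a₀`.
  by_contra hbad
  rw [Filter.not_eventually] at hbad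
  -- the minimal polynomials of the `s i`, and the possible values of `s` over `c₀`
  let M : ι → ℂ[X][X] := fun i => minpoly ℂ[X] (s i)
  have hM : ∀ i, (M i).Monic := fun i => minpoly.monic (Algebra.IsIntegral.isIntegral (s i))
  have hroot : ∀ (c : ℂ) (y : S →+* ℂ), y.comp (algebraMap ℂ[X] S) = evalRingHom c →
      ∀ i, ((M i).map (evalRingHom c)).eval (y (s i)) = 0 := by
    intro c y hy i
    rw [Polynomial.eval_map, ← hy, ← Polynomial.hom_eval₂, ← Polynomial.aeval_def,
      minpoly.aeval, map_zero]
  have hconst : ∀ (c : ℂ) (y : S →+* ℂ), y.comp (algebraMap ℂ[X] S) = evalRingHom c →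
      ∀ z : ℂ, y (algebraMap ℂ[X] S (C z)) = z := by
    intro c y hy z
    rw [← RingHom.comp_apply, hy, coe_evalRingHom, eval_C]
  let a₀ : ι → ℂ := fun i => x (s i)
  let Φ : Finset (ι → ℂ) := Fintype.piFinset fun i => ((M i).map (evalRingHom c₀)).roots.toFinset
  have hΦ : ∀ a : ι → ℂ, (∀ i, ((M i).map (evalRingHom c₀)).eval (a i) = 0) → a ∈ Φ := by
    intro a ha
    rw [Fintype.mem_piFinset]
    intro i
    rw [Multiset.mem_toFinset, Polynomial.mem_roots ((hM i).map _).ne_zero]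
    exact ha i
  have hj : ∀ a ∈ Φ.erase a₀, ∃ i, a i ≠ a₀ i := fun a ha =>
    Function.ne_iff.1 (Finset.ne_of_mem_erase ha)
  choose! j hj using hj
  -- an element that separates the given point from the other points over `c₀`
  let u : S := ∏ a ∈ Φ.erase a₀, (s (j a) - algebraMap ℂ[X] S (C (a (j a))))
  have hu : ∀ (c : ℂ) (y : S →+* ℂ), y.comp (algebraMap ℂ[X] S) = evalRingHom c →
      y u = ∏ a ∈ Φ.erase a₀, (y (s (j a)) - a (j a)) := by
    intro c y hy
    rw [map_prod]
    exact Finset.prod_congr rfl fun a _ => by rw [map_sub, hconst c y hy]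
  have hxu : x u ≠ 0 := by
    rw [hu c₀ x hx, Finset.prod_ne_zero_iff]
    intro a ha h0
    exact hj a ha (sub_eq_zero.1 h0).symm
  -- Within this tolerance `Y c u` stays away from zero, whereas it would tend to zero if the limit
  -- were another candidate.
  have hpos : 0 < ‖x u‖ / 2 := by positivity
  have hev := Algebra.IsIntegral.eventually_exists_norm_sub_lt x c₀ hx u hpos
  have : Nonempty (S →+* ℂ) := ⟨x⟩
  choose! Y hY using fun c (h : ∃ y : S →+* ℂ, y.comp (algebraMap ℂ[X] S) = evalRingHom c ∧
      ‖y u - x u‖ < ‖x u‖ / 2) => h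
  have hne : (𝓝 c₀ ⊓ 𝓟 {c | ¬∃ y : S →+* ℂ, y.comp (algebraMap ℂ[X] S) = evalRingHom c ∧
      ∀ i, ‖y (s i) - x (s i)‖ < ε}).NeBot := Filter.frequently_mem_iff_neBot.1 hbad
  let G := Ultrafilter.of (𝓝 c₀ ⊓ 𝓟 {c | ¬∃ y : S →+* ℂ,
    y.comp (algebraMap ℂ[X] S) = evalRingHom c ∧ ∀ i, ‖y (s i) - x (s i)‖ < ε})
  have hG : (G : Filter ℂ) ≤ 𝓝 c₀ := (Ultrafilter.of_le _).trans inf_le_left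
  have hGbad : ∀ᶠ c in (G : Filter ℂ), ¬∃ y : S →+* ℂ,
      y.comp (algebraMap ℂ[X] S) = evalRingHom c ∧ ∀ i, ‖y (s i) - x (s i)‖ < ε :=
    (Ultrafilter.of_le _).trans inf_le_right (mem_principal_self _)
  have hGY : ∀ᶠ c in (G : Filter ℂ), (Y c).comp (algebraMap ℂ[X] S) = evalRingHom c ∧
      ‖Y c u - x u‖ < ‖x u‖ / 2 := (hev.filter_mono hG).mono fun c hc => hY c hc
  let φ : ℂ → ι → ℂ := fun c i => Y c (s i)
  -- the values of `s` stay bounded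
  let b : ℂ → ℝ := fun c => ∑ i, (1 + ∑ k ∈ Finset.range (M i).natDegree, ‖((M i).coeff k).eval c‖)
  have hb : Continuous b := by fun_prop
  have hφb : ∀ᶠ c in (G : Filter ℂ), φ c ∈ Metric.closedBall (0 : ι → ℂ) (b c₀ + 1) := by
    have h1 : ∀ᶠ c in (G : Filter ℂ), b c < b c₀ + 1 :=
      hG ((hb.tendsto c₀).eventually_lt_const (by linarith))
    filter_upwards [h1, hGY] with c hc hy
    have hb0 : 0 ≤ b c := Finset.sum_nonneg fun i _ => by positivity
    rw [mem_closedBall_zero_iff, pi_norm_le_iff_of_nonneg (by linarith)]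
    intro i
    refine le_trans ?_ hc.le
    refine le_trans ?_ (Finset.single_le_sum (f := fun i =>
      1 + ∑ k ∈ Finset.range (M i).natDegree, ‖((M i).coeff k).eval c‖)
      (fun i _ => by positivity) (Finset.mem_univ i))
    have h2 := ((hM i).map (evalRingHom c)).norm_le_of_isRoot (hroot c (Y c) hy.1 i)
    simpa only [(hM i).natDegree_map, coeff_map, coe_evalRingHom] using h2
  obtain ⟨a, -, ha⟩ := (isCompact_closedBall (0 : ι → ℂ) (b c₀ + 1)).ultrafilter_le_nhds
    (G.map φ) (le_principal_iff.2 hφb)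
  have hφa : Tendsto φ G (𝓝 a) := ha
  have hφai : ∀ i, Tendsto (fun c => φ c i) G (𝓝 (a i)) := fun i => (tendsto_pi_nhds.1 hφa) i
  have haΦ : a ∈ Φ := by
    refine hΦ a fun i => ?_
    have h1 : Tendsto (fun c => ((M i).map (evalRingHom c)).eval (φ c i)) G
        (𝓝 (((M i).map (evalRingHom c₀)).eval (a i))) := by
      simp only [Polynomial.eval_map, Polynomial.eval₂_eq_sum_range, coe_evalRingHom]
      refine tendsto_finsetSum _ fun k _ => Tendsto.mul ?_ ((hφai i).pow k)
      exact (((M i).coeff k).continuous.tendsto c₀).mono_left hG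
    have h2 : Tendsto (fun c => ((M i).map (evalRingHom c)).eval (φ c i)) G (𝓝 0) :=
      tendsto_const_nhds.congr' (hGY.mono fun c hc => (hroot c (Y c) hc.1 i).symm)
    exact tendsto_nhds_unique h1 h2
  have haa₀ : a = a₀ := by
    by_contra hne
    have hmem : a ∈ Φ.erase a₀ := Finset.mem_erase.2 ⟨hne, haΦ⟩
    have h1 : Tendsto (fun c => ∏ d ∈ Φ.erase a₀, (φ c (j d) - d (j d))) G
        (𝓝 (∏ d ∈ Φ.erase a₀, (a (j d) - d (j d)))) :=
      tendsto_finsetProd _ fun d _ => (hφai (j d)).sub tendsto_const_nhds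
    rw [Finset.prod_eq_zero (f := fun d => a (j d) - d (j d)) hmem (sub_self _)] at h1
    have h2 := h1.norm
    rw [_root_.norm_zero] at h2
    obtain ⟨c, hc1, hc2⟩ := ((h2.eventually_lt_const hpos).and hGY).exists
    rw [← hu c (Y c) hc2.1] at hc1
    have h3 := norm_sub_norm_le (x u) (Y c u)
    rw [norm_sub_rev] at h3
    linarith [hc2.2]
  have hnear : ∀ᶠ c in (G : Filter ℂ), ∀ i, ‖φ c i - a₀ i‖ < ε := by
    rw [Filter.eventually_all]
    intro i
    have h1 := ((hφai i).sub (tendsto_const_nhds (x := a₀ i))).norm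
    rw [haa₀, sub_self, _root_.norm_zero] at h1
    exact h1.eventually_lt_const hε
  obtain ⟨c, hc1, hc2, hc3⟩ := (hGbad.and (hGY.and hnear)).exists
  exact hc1 ⟨Y c, hc2.1, hc3⟩

end OpenMapping

/-! ### The open mapping theorem on affine varieties. -/

section OpenMapping

open Polynomial

/-- Points of an affine curve `C` over the line lift to nearby points if `C` satisfies
Zariski's main theorem at the given point. -/
theorem Algebra.ZariskisMainProperty.eventually_exists_forall_norm_sub_lt {S : Type*} [CommRing S]
    [IsDomain S] [Algebra ℂ[X] S] [FaithfulSMul ℂ[X] S] (x : S →+* ℂ) (c₀ : ℂ)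
    (hx : x.comp (algebraMap ℂ[X] S) = evalRingHom c₀)
    (hZ : Algebra.ZariskisMainProperty ℂ[X] (RingHom.ker x))
    {ι : Type*} [Finite ι] (b : ι → S) {ε : ℝ} (hε : 0 < ε) :
    ∀ᶠ c in 𝓝 c₀, ∃ y : S →+* ℂ, y.comp (algebraMap ℂ[X] S) = evalRingHom c ∧
      ∀ i, ‖y (b i) - x (b i)‖ < ε := by
  have := Fintype.ofFinite ι
  -- After inverting `r`, which is nonzero at `x`, the ring `S` agrees with the integral closure of
  -- `ℂ[X]`. So each `b i` is an integral element over a power of `r`, and it suffices to move these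
  -- numerators and `r`.
  obtain ⟨r, hr, hbij⟩ := hZ
  have hxr : x r.1 ≠ 0 := hr
  have hm : ∀ i, ∃ m, IsIntegral ℂ[X] (r.1 ^ m * b i) := by
    intro i
    have h1 := (Localization.awayMap_surjective_iff
      (f := (integralClosure ℂ[X] S).val.toRingHom) (r := r)).1 hbij.2 (b i)
    obtain ⟨a, m, ham⟩ := h1
    refine ⟨m, ?_⟩
    have : r.1 ^ m * b i = a.1 := by simpa using ham.symm
    rw [this]
    exact a.2
  choose m hm using hm
  let s : Option ι → integralClosure ℂ[X] S := fun o => o.elim r fun i => ⟨_, hm i⟩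
  let x' : integralClosure ℂ[X] S →+* ℂ := x.comp (integralClosure ℂ[X] S).val.toRingHom
  have hx' : x'.comp (algebraMap ℂ[X] (integralClosure ℂ[X] S)) = evalRingHom c₀ := hx
  let p₀ : Option ι → ℂ := fun o => x' (s o)
  have hp : ∀ᶠ p in 𝓝 p₀, p none ≠ 0 ∧
      ∀ i, ‖p (some i) / p none ^ m i - p₀ (some i) / p₀ none ^ m i‖ < ε := by
    have hc : ∀ o, Tendsto (fun p : Option ι → ℂ => p o) (𝓝 p₀) (𝓝 (p₀ o)) :=
      fun o => (continuous_apply o).tendsto p₀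
    refine ((hc none).eventually_ne hxr).and (Filter.eventually_all.2 fun i => ?_)
    have h1 := ((((hc (some i)).div ((hc none).pow (m i)) (pow_ne_zero _ hxr)).sub
      (tendsto_const_nhds (x := p₀ (some i) / p₀ none ^ m i)))).norm
    rw [sub_self, _root_.norm_zero] at h1
    exact h1.eventually_lt_const hε
  obtain ⟨δ, hδ, hpδ⟩ := Metric.eventually_nhds_iff.1 hp
  filter_upwards [Algebra.IsIntegral.eventually_exists_forall_norm_sub_lt x' c₀ hx' s hδ]
    with c ⟨y, hy, hys⟩
  obtain ⟨hy0, hyb⟩ := hpδ (y := fun o => y (s o)) <| by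
    rw [dist_pi_lt_iff hδ]
    intro o
    rw [dist_eq_norm]
    exact hys o
  let e := RingEquiv.ofBijective _ hbij
  let l : Localization.Away r →+* ℂ := IsLocalization.Away.lift r (g := y) (isUnit_iff_ne_zero.2 hy0)
  let z : S →+* ℂ := (l.comp e.symm.toRingHom).comp (algebraMap S _)
  have hz : ∀ a : integralClosure ℂ[X] S, z a.1 = y a := by
    intro a
    change l (e.symm (algebraMap S _ a.1)) = y a
    have h1 : e.symm (algebraMap S _ a.1) = algebraMap _ _ a := by
      rw [RingEquiv.symm_apply_eq]
      change _ = Localization.awayMap (integralClosure ℂ[X] S).val.toRingHom r (algebraMap _ _ a)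
      rw [Localization.awayMap, IsLocalization.Away.map, IsLocalization.map_eq]
      rfl
    rw [h1]
    exact IsLocalization.Away.lift_eq r _ a
  have hzb : ∀ i, z (b i) = y (s (some i)) / y (s none) ^ m i := by
    intro i
    rw [eq_div_iff (pow_ne_zero _ hy0), ← hz, ← hz, ← map_pow, ← map_mul, mul_comm]
    rfl
  have hxb : ∀ i, x (b i) = p₀ (some i) / p₀ none ^ m i := by
    intro i
    change x (b i) = x (r.1 ^ m i * b i) / x r.1 ^ m i
    rw [eq_div_iff (pow_ne_zero _ hxr), map_mul, map_pow, mul_comm]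
  refine ⟨z, RingHom.ext fun q => ?_, fun i => ?_⟩
  · rw [← hy]
    exact hz (algebraMap _ _ q)
  · rw [hzb, hxb]
    exact hyb i

/-- A point of an affine scheme over the line is quasi-finite if it is an irreducible component
of its fibre. -/
theorem Algebra.QuasiFiniteAt.ker_of_mem_minimalPrimes {S : Type*} [CommRing S]
    [Algebra ℂ[X] S] [Algebra.FiniteType ℂ[X] S] (x : S →+* ℂ)
    [(RingHom.ker x).IsPrime] (c₀ : ℂ)
    (hx : x.comp (algebraMap ℂ[X] S) = evalRingHom c₀)
    (hmin : RingHom.ker x ∈ (Ideal.span {algebraMap ℂ[X] S (X - C c₀)}).minimalPrimes) :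
    Algebra.QuasiFiniteAt ℂ[X] (RingHom.ker x) := by
  classical
  have hN : IsNoetherianRing S := Algebra.FiniteType.isNoetherianRing ℂ[X] S
  have hsurj : Function.Surjective x := fun z =>
    ⟨algebraMap ℂ[X] S (C z), by rw [← RingHom.comp_apply, hx, coe_evalRingHom, eval_C]⟩
  have hmax : (RingHom.ker x).IsMaximal := RingHom.ker_isMaximal_of_surjective x hsurj
  let q : PrimeSpectrum S := ⟨RingHom.ker x, hmax.isPrime⟩
  set I := Ideal.span {algebraMap ℂ[X] S (X - C c₀)} with hI
  have hfin := Ideal.finite_minimalPrimes_of_isNoetherianRing S I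
  -- `f` vanishes on all other components of the fibre but not at the point, so its basic open set
  -- isolates the point in the fibre.
  obtain ⟨f, hf, hfq⟩ : ∃ f ∈ (hfin.toFinset.erase (RingHom.ker x)).inf _root_.id, f ∉ RingHom.ker x := by
    rw [← SetLike.not_le_iff_exists, hmax.isPrime.inf_le']
    rintro ⟨J, hJ, hJle⟩
    rw [Finset.mem_erase, Set.Finite.mem_toFinset] at hJ
    exact hJ.1 (le_antisymm hJle (hmin.2 hJ.2.1 hJle))
  refine Algebra.QuasiFiniteAt.of_isOpen_singleton_fiber q ?_
  refine isOpen_induced_iff.2 ⟨PrimeSpectrum.basicOpen f, (PrimeSpectrum.basicOpen f).2, ?_⟩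
  ext ⟨M, hM⟩
  simp only [Set.mem_preimage, SetLike.mem_coe, PrimeSpectrum.mem_basicOpen,
    Set.mem_singleton_iff]
  refine ⟨fun hfM => Subtype.ext ?_, fun h => ?_⟩
  swap
  · have h1 : M = q := congrArg Subtype.val h
    rw [h1]
    exact hfq
  have hIM : I ≤ M.asIdeal := by
    rw [hI, Ideal.span_singleton_le_iff_mem]
    have h1 : X - C c₀ ∈ (PrimeSpectrum.comap (algebraMap ℂ[X] S) q).asIdeal := by
      change x (algebraMap ℂ[X] S (X - C c₀)) = 0
      rw [← RingHom.comp_apply, hx]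
      simp
    have h2 : PrimeSpectrum.comap (algebraMap ℂ[X] S) M =
      PrimeSpectrum.comap (algebraMap ℂ[X] S) q := hM
    rw [← h2] at h1
    exact h1
  obtain ⟨J, hJ, hJM⟩ := Ideal.exists_minimalPrimes_le hIM
  have hJq : J = RingHom.ker x := by
    by_contra hne
    refine hfM (hJM ?_)
    exact (Finset.inf_le (f := _root_.id)
      (Finset.mem_erase.2 ⟨hne, hfin.mem_toFinset.2 hJ⟩) : _ ≤ J) hf
  refine PrimeSpectrum.ext ?_
  exact (hmax.eq_of_le M.2.ne_top (hJq ▸ hJM)).symm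

/-- Through every point `M` of an affine variety on which `f` does not vanish identically passes
a curve on which `f` does not vanish identically. -/
theorem Ideal.exists_isPrime_and_mem_minimalPrimes_sup_span {B : Type*} [CommRing B] [IsDomain B]
    [IsNoetherianRing B] (M : Ideal B) [M.IsMaximal] (f : B) (hf : f ≠ 0) (hfM : f ∈ M) :
    ∃ Q : Ideal B, Q.IsPrime ∧ Q ≤ M ∧ f ∉ Q ∧ M ∈ (Q ⊔ Ideal.span {f}).minimalPrimes := by
  classical
  have hM : M.IsPrime := Ideal.IsMaximal.isPrime ‹_›
  obtain ⟨(Q : Ideal B), ⟨hQ, hQM, hfQ⟩, hmax⟩ := set_has_maximal_iff_noetherian.2 (inferInstance :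
    IsNoetherian B B) {Q : Ideal B | Q.IsPrime ∧ Q ≤ M ∧ f ∉ Q} ⟨⊥, Ideal.isPrime_bot, bot_le, hf⟩
  refine ⟨Q, hQ, hQM, hfQ, ?_⟩
  -- Prime avoidance gives `t ∈ M` outside every minimal prime of `Q + (f)`. By maximality of `Q`, a
  -- prime `N` minimal over `Q + (t)` contains `f`, which forces an intermediate prime between `Q`
  -- and `N`.
  by_contra hnot
  have hle : Q ⊔ Ideal.span {f} ≤ M := sup_le hQM ((Ideal.span_singleton_le_iff_mem _).2 hfM)
  have hfin := Ideal.finite_minimalPrimes_of_isNoetherianRing B (Q ⊔ Ideal.span {f})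
  obtain ⟨t, htM, ht⟩ : ∃ t ∈ M, ∀ J ∈ (Q ⊔ Ideal.span {f}).minimalPrimes, t ∉ J := by
    by_contra! hc
    have h1 : (M : Set B) ⊆ ⋃ J ∈ (Q ⊔ Ideal.span {f}).minimalPrimes, (J : Set B) := by
      intro t ht
      obtain ⟨J, hJ, htJ⟩ := hc t ht
      exact Set.mem_biUnion hJ htJ
    obtain ⟨J, hJ, hMJ⟩ := (Ideal.subset_union_prime_finite hfin (f := _root_.id) ⊥ ⊥
      fun J hJ _ _ => hJ.1.1).1 h1
    have : M = J := Ideal.IsMaximal.eq_of_le ‹_› hJ.1.1.ne_top hMJ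
    exact hnot (this ▸ hJ)
  have hle' : Q ⊔ Ideal.span {t} ≤ M := sup_le hQM ((Ideal.span_singleton_le_iff_mem _).2 htM)
  obtain ⟨N, hN, hNM⟩ := Ideal.exists_minimalPrimes_le hle'
  have hNp : N.IsPrime := hN.1.1
  have hQN : Q ≤ N := le_sup_left.trans hN.1.2
  have htN : t ∈ N := hN.1.2 (Ideal.mem_sup_right (Ideal.mem_span_singleton_self t))
  have hfN : f ∈ N := by
    by_contra hfN
    refine hmax N ⟨hNp, hNM, hfN⟩ (lt_of_le_of_ne hQN fun h => ?_)
    obtain ⟨J, hJ, -⟩ := Ideal.exists_minimalPrimes_le hle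
    exact ht J hJ (hJ.1.2 (Ideal.mem_sup_left (h ▸ htN)))
  obtain ⟨J, hJ, hJN⟩ := Ideal.exists_minimalPrimes_le
    (sup_le hQN ((Ideal.span_singleton_le_iff_mem _).2 hfN) : Q ⊔ Ideal.span {f} ≤ N)
  have hJp : J.IsPrime := hJ.1.1
  have hQJ : Q < J := lt_of_le_of_ne (le_sup_left.trans hJ.1.2) fun h =>
    hfQ (h ▸ hJ.1.2 (Ideal.mem_sup_right (Ideal.mem_span_singleton_self f)))
  have hJN' : J < N := lt_of_le_of_ne hJN fun h => ht J hJ (h ▸ htN)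
  -- the chain `Q < J < N` contradicts Krull's principal ideal theorem
  let mk := Ideal.Quotient.mk Q
  have hprime : ∀ K : Ideal B, K.IsPrime → Q ≤ K → (K.map mk).IsPrime := fun K _ h =>
    Ideal.isPrime_map_quotientMk_of_isPrime h
  have hcm : ∀ K : Ideal B, Q ≤ K → (K.map mk).comap mk = K := fun K h => Ideal.comap_map_mk h
  have hJ' := hprime J hJp hQJ.le
  have hN' := hprime N hNp hQN
  have hNmin : N.map mk ∈ (Ideal.span {mk t}).minimalPrimes := by
    refine ⟨⟨hN', ?_⟩, ?_⟩
    · rw [Ideal.span_singleton_le_iff_mem]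
      exact Ideal.mem_map_of_mem _ htN
    · rintro K ⟨hK, htK⟩ hKN
      rw [Ideal.span_singleton_le_iff_mem] at htK
      have hQK : Q ≤ K.comap mk := fun p hp => by
        rw [Ideal.mem_comap, Ideal.Quotient.eq_zero_iff_mem.2 hp]
        exact K.zero_mem
      have := hN.2 ⟨hK.comap mk, sup_le hQK ((Ideal.span_singleton_le_iff_mem _).2 htK)⟩
        ((Ideal.comap_mono hKN).trans (hcm N hQN).le)
      rw [Ideal.map_le_iff_le_comap]
      exact this
  have h1 := Ideal.height_le_one_of_isPrincipal_of_mem_minimalPrimes _ _ hNmin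
  have h2 : ⊥ < J.map mk := by
    rw [bot_lt_iff_ne_bot]
    intro h0
    have := hcm J hQJ.le
    rw [h0, ← RingHom.ker_eq_comap_bot, Ideal.mk_ker] at this
    exact hQJ.ne this
  have h3 : J.map mk < N.map mk := lt_of_le_of_ne (Ideal.map_mono hJN) fun h =>
    hJN'.ne (by rw [← hcm J hQJ.le, h, hcm N hQN])
  have h4 := Ideal.height_add_one_le_of_lt_of_isPrime h2
  have h5 := Ideal.height_add_one_le_of_lt_of_isPrime h3
  have h6 : (1 : ℕ∞) + 1 ≤ 1 :=
    le_trans (by gcongr; exact le_trans le_add_self h4) (h5.trans h1)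
  exact absurd h6 (by decide)

/-- A nonconstant element of a domain over an algebraically closed field is transcendental. -/
theorem IsAlgClosed.injective_aeval_of_notMem_range {K S : Type*} [Field K] [IsAlgClosed K]
    [CommRing S] [IsDomain S] [Algebra K S] (h : S) (hh : h ∉ Set.range (algebraMap K S)) :
    Function.Injective (aeval h : K[X] →ₐ[K] S) := by
  rw [← transcendental_iff_injective]
  intro halg
  have hint : IsIntegral K h := halg.isIntegral
  have : Algebra.IsIntegral K (Algebra.adjoin K {h}) :=
    Algebra.IsIntegral.adjoin (by simpa using hint)
  obtain ⟨z, hz⟩ := (IsAlgClosed.algebraMap_bijective_of_isIntegral (k := K)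
    (K := Algebra.adjoin K {h})).2 ⟨h, Algebra.self_mem_adjoin_singleton K h⟩
  exact hh ⟨z, congr($hz.1)⟩

/-- **Open mapping theorem**: a nonconstant regular function on an irreducible affine complex
variety is open in the Euclidean topology. -/
theorem Algebra.FiniteType.eventually_exists_forall_norm_sub_lt {B : Type*} [CommRing B]
    [IsDomain B] [Algebra ℂ B] [Algebra.FiniteType ℂ B] (x : B →ₐ[ℂ] ℂ) (h : B)
    (hh : h - algebraMap ℂ B (x h) ≠ 0) {ι : Type*} [Finite ι] (b : ι → B) {ε : ℝ} (hε : 0 < ε) :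
    ∀ᶠ c in 𝓝 (x h), ∃ y : B →ₐ[ℂ] ℂ, y h = c ∧ ∀ i, ‖y (b i) - x (b i)‖ < ε := by
  have hN : IsNoetherianRing B := Algebra.FiniteType.isNoetherianRing ℂ B
  have hsurj : Function.Surjective x := fun z => ⟨algebraMap ℂ B z, x.commutes z⟩
  have hmax : (RingHom.ker x).IsMaximal := RingHom.ker_isMaximal_of_surjective x hsurj
  -- On the subvariety of `Q` the function `h` is still nonconstant, and `x` is a component of its
  -- fibre. So `x` is a quasi-finite point and Zariski's main theorem applies.
  obtain ⟨Q, hQ, hQM, hfQ, hmin⟩ := Ideal.exists_isPrime_and_mem_minimalPrimes_sup_span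
    (RingHom.ker x) _ hh (by rw [RingHom.mem_ker, map_sub, x.commutes]; exact sub_self _)
  let mk := Ideal.Quotient.mkₐ ℂ Q
  have hmk : Function.Surjective mk := Ideal.Quotient.mk_surjective
  let x' : B ⧸ Q →ₐ[ℂ] ℂ := Ideal.Quotient.liftₐ Q x fun a ha => hQM ha
  have hx'mk : ∀ a, x' (mk a) = x a := fun a => rfl
  have hnr : mk h ∉ Set.range (algebraMap ℂ (B ⧸ Q)) := by
    rintro ⟨z, hz⟩
    have h1 : x h = z := by rw [← hx'mk, ← hz, x'.commutes]; rfl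
    apply hfQ
    rw [← Ideal.Quotient.eq_zero_iff_mem]
    change mk _ = 0
    rw [map_sub, mk.commutes, h1, hz, sub_self]
  let _ : Algebra ℂ[X] (B ⧸ Q) := (aeval (mk h) : ℂ[X] →ₐ[ℂ] B ⧸ Q).toRingHom.toAlgebra
  have halg : ∀ p : ℂ[X], algebraMap ℂ[X] (B ⧸ Q) p = aeval (mk h) p := fun p => rfl
  have : IsScalarTower ℂ ℂ[X] (B ⧸ Q) := IsScalarTower.of_algebraMap_eq fun z => by
    rw [halg, Polynomial.algebraMap_apply, aeval_C]
    rfl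
  have : Algebra.FiniteType ℂ[X] (B ⧸ Q) :=
    Algebra.FiniteType.of_restrictScalars_finiteType ℂ ℂ[X] (B ⧸ Q)
  have : FaithfulSMul ℂ[X] (B ⧸ Q) := (faithfulSMul_iff_algebraMap_injective _ _).2
    (IsAlgClosed.injective_aeval_of_notMem_range (mk h) hnr)
  have hx' : (x' : B ⧸ Q →+* ℂ).comp (algebraMap ℂ[X] (B ⧸ Q)) = evalRingHom (x h) := by
    apply Polynomial.ringHom_ext
    · intro z
      rw [RingHom.comp_apply, halg, aeval_C]
      simp
    · rw [RingHom.comp_apply, halg, aeval_X]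
      simp [hx'mk]
  have hker : (RingHom.ker (x' : B ⧸ Q →+* ℂ)).comap mk = RingHom.ker x := rfl
  have hmin' : RingHom.ker (x' : B ⧸ Q →+* ℂ) ∈
      (Ideal.span {algebraMap ℂ[X] (B ⧸ Q) (X - C (x h))}).minimalPrimes := by
    have heq : algebraMap ℂ[X] (B ⧸ Q) (X - C (x h)) = mk (h - algebraMap ℂ B (x h)) := by
      rw [halg, map_sub, aeval_X, aeval_C, map_sub, mk.commutes]
    rw [heq]
    refine ⟨⟨RingHom.ker_isPrime _, ?_⟩, ?_⟩
    · rw [Ideal.span_singleton_le_iff_mem]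
      change x (h - algebraMap ℂ B (x h)) = 0
      rw [map_sub, x.commutes]
      exact sub_self _
    · rintro K ⟨hK, hfK⟩ hKx
      rw [Ideal.span_singleton_le_iff_mem] at hfK
      have h1 := hmin.2 ⟨hK.comap mk, sup_le (fun a ha => ?_)
        ((Ideal.span_singleton_le_iff_mem _).2 hfK)⟩ (Ideal.comap_mono hKx)
      · intro a ha
        obtain ⟨a, rfl⟩ := hmk a
        exact h1 ha
      · have : mk a = 0 := Ideal.Quotient.eq_zero_iff_mem.2 ha
        rw [Ideal.mem_comap, this]
        exact K.zero_mem
  have hprime : (RingHom.ker (x' : B ⧸ Q →+* ℂ)).IsPrime := RingHom.ker_isPrime _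
  have hqf := Algebra.QuasiFiniteAt.ker_of_mem_minimalPrimes (x' : B ⧸ Q →+* ℂ) (x h) hx' hmin'
  filter_upwards [(Algebra.ZariskisMainProperty.of_finiteType (R := ℂ[X])
    (RingHom.ker (x' : B ⧸ Q →+* ℂ))).eventually_exists_forall_norm_sub_lt _ (x h) hx'
    (fun i => mk (b i)) hε] with c ⟨y, hy, hyb⟩
  let y' : B →ₐ[ℂ] ℂ := { y.comp mk.toRingHom with
    commutes' := fun z => by
      change y (mk (algebraMap ℂ B z)) = z
      have h1 : mk (algebraMap ℂ B z) = algebraMap ℂ[X] (B ⧸ Q) (C z) := by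
        rw [halg, aeval_C, mk.commutes]
      rw [h1, ← RingHom.comp_apply, hy, coe_evalRingHom, eval_C] }
  refine ⟨y', ?_, fun i => hyb i⟩
  change y (mk h) = c
  have h1 : mk h = algebraMap ℂ[X] (B ⧸ Q) X := by rw [halg, aeval_X]
  rw [h1, ← RingHom.comp_apply, hy, coe_evalRingHom, eval_X]

end OpenMapping

/-! ### The maximum principle on irreducible varieties. -/

section MaximumPrinciple

/-- The absolute value has no local maximum on the complex plane. -/
theorem Complex.frequently_norm_lt (z : ℂ) : ∃ᶠ c in 𝓝 z, ‖z‖ < ‖c‖ := by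
  intro h
  have hmax : IsLocalMax norm z := by
    filter_upwards [h] with c hc
    exact not_lt.1 hc
  have hopen := Complex.eventually_eq_of_isLocalMax_norm (f := fun c : ℂ => c) (c := z)
    (Eventually.of_forall fun c => differentiableAt_id) hmax
  obtain ⟨ε, hε, hball⟩ := Metric.eventually_nhds_iff.1 hopen
  have h1 := hball (y := z + (ε / 2 : ℝ)) (by
    rw [dist_eq_norm, add_sub_cancel_left, Complex.norm_real, Real.norm_eq_abs,
      abs_of_pos (by positivity)]
    linarith)
  have h2 : ((ε / 2 : ℝ) : ℂ) = 0 := by simpa using h1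
  have h3 : ε / 2 = 0 := by exact_mod_cast h2
  linarith

open MvPolynomial in
/-- **Maximum principle**: the absolute value of a nonconstant quotient of polynomials has no local
maximum on an irreducible variety. -/
theorem MvPolynomial.frequently_norm_div_lt {n : ℕ} (P : Ideal (MvPolynomial (Fin n) ℂ))
    [P.IsPrime] (w₁ : Fin n → ℂ) (hw₁ : ∀ p ∈ P, eval w₁ p = 0) (f g : MvPolynomial (Fin n) ℂ)
    (hg : eval w₁ g ≠ 0) (hfg : f * C (eval w₁ g) - C (eval w₁ f) * g ∉ P) :
    ∃ᶠ w in 𝓝 w₁, (∀ p ∈ P, eval w p = 0) ∧ eval w g ≠ 0 ∧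
      ‖eval w₁ f / eval w₁ g‖ < ‖eval w f / eval w g‖ := by
  let A := MvPolynomial (Fin n) ℂ ⧸ P
  let mk : MvPolynomial (Fin n) ℂ →ₐ[ℂ] A := Ideal.Quotient.mkₐ ℂ P
  -- Inverting `g` turns `f / g` into a regular function, which takes all values near its value at
  -- `w₁`, including some of larger modulus.
  let B := Localization.Away (mk g)
  have hmk0 : ∀ p, mk p = 0 ↔ p ∈ P := fun p => Ideal.Quotient.eq_zero_iff_mem
  have hg0 : mk g ≠ 0 := fun h => hg (hw₁ g ((hmk0 g).1 h))
  have hle : Submonoid.powers (mk g) ≤ nonZeroDivisors A :=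
    powers_le_nonZeroDivisors_of_noZeroDivisors hg0
  have hB : IsDomain B := IsLocalization.isDomain_localization hle
  have hinj : Function.Injective (algebraMap A B) := IsLocalization.injective B hle
  let x₀ : A →ₐ[ℂ] ℂ := Ideal.Quotient.liftₐ P (aeval w₁) hw₁
  have hx₀ : ∀ p, x₀ (mk p) = eval w₁ p := fun p => rfl
  have hunit : IsUnit (x₀ (mk g)) := isUnit_iff_ne_zero.2 hg
  let x : B →ₐ[ℂ] ℂ := IsLocalization.Away.liftAlgHom (mk g) (f := x₀) hunit
  have hx : ∀ p, x (algebraMap A B (mk p)) = eval w₁ p := by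
    intro p
    rw [← hx₀]
    exact IsLocalization.Away.lift_eq (mk g) (g := x₀.toRingHom) hunit _
  let h : B := algebraMap A B (mk f) * IsLocalization.Away.invSelf (mk g)
  have hh : h * algebraMap A B (mk g) = algebraMap A B (mk f) := by
    rw [mul_assoc, mul_comm (IsLocalization.Away.invSelf (mk g)),
      IsLocalization.Away.mul_invSelf, mul_one]
  have hxh : x h = eval w₁ f / eval w₁ g := by
    rw [eq_div_iff hg, ← hx, ← map_mul, hh, hx]
  have hne : h - algebraMap ℂ B (x h) ≠ 0 := by
    intro h0
    apply hfg
    rw [← hmk0]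
    apply hinj
    have h1 : algebraMap A B (mk f) = algebraMap ℂ B (x h) * algebraMap A B (mk g) := by
      rw [← hh, sub_eq_zero.1 h0, AlgHom.commutes]
      rfl
    have h2 : ∀ z : ℂ, algebraMap A B (mk (C z)) = algebraMap ℂ B z := by
      intro z
      rw [show mk (C z) = algebraMap ℂ A z from mk.commutes z, ← IsScalarTower.algebraMap_apply]
    rw [map_sub, map_sub, map_mul, map_mul, map_mul, map_mul, h1, h2, h2, hxh, map_zero,
      mul_right_comm, ← map_mul, div_mul_cancel₀ _ hg, sub_self]
  have key : ∀ ε > 0, ∃ w : Fin n → ℂ, dist w w₁ < ε ∧ (∀ p ∈ P, eval w p = 0) ∧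
      eval w g ≠ 0 ∧ ‖eval w₁ f / eval w₁ g‖ < ‖eval w f / eval w g‖ := by
    intro ε hε
    obtain ⟨c, hc, y, hyh, hyb⟩ := ((Complex.frequently_norm_lt (x h)).and_eventually
      (Algebra.FiniteType.eventually_exists_forall_norm_sub_lt x h hne
        (fun i : Fin n => algebraMap A B (mk (X i))) hε)).exists
    let w : Fin n → ℂ := fun i => y (algebraMap A B (mk (X i)))
    have hw : ∀ p, y (algebraMap A B (mk p)) = eval w p := by
      intro p
      have : (y.comp (IsScalarTower.toAlgHom ℂ A B)).comp mk = aeval w :=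
        MvPolynomial.algHom_ext fun i => by simp [w]
      exact congr($this p)
    have hgw : eval w g ≠ 0 := by
      rw [← hw]
      exact ((IsLocalization.Away.algebraMap_isUnit (S := B) (mk g)).map y).ne_zero
    refine ⟨w, ?_, ?_, hgw, ?_⟩
    · rw [dist_pi_lt_iff hε]
      intro i
      rw [dist_eq_norm]
      have := hyb i
      rwa [hx, eval_X] at this
    · intro p hp
      rw [← hw, (hmk0 p).2 hp, map_zero, map_zero]
    · have : eval w f / eval w g = c := by
        rw [div_eq_iff hgw, ← hw, ← hw, ← hyh, ← map_mul, hh]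
      rw [this, ← hxh]
      exact hc
  rw [Metric.nhds_basis_ball.frequently_iff]
  intro ε hε
  obtain ⟨w, hw, h'⟩ := key ε hε
  exact ⟨w, hw, h'⟩

end MaximumPrinciple

/-! ### Properness of the logarithmic map; Laurent monomials. -/

section LogMap

open MvPolynomial

/-- The logarithmic map on `ℂⁿ`. -/
noncomputable def logNorm {n : ℕ} (w : Fin n → ℂ) : EuclideanSpace ℝ (Fin n) :=
  WithLp.toLp 2 fun i => Real.log ‖w i‖

theorem continuousAt_logNorm {n : ℕ} {w : Fin n → ℂ} (hw : ∀ i, w i ≠ 0) :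
    ContinuousAt logNorm w := by
  refine (PiLp.continuous_toLp 2 _).continuousAt.comp (continuousAt_pi.2 fun i => ?_)
  exact ((continuous_apply i).norm.continuousAt).log (norm_ne_zero_iff.2 (hw i))

/-- The logarithmic map is proper on a Zariski closed subset of the torus. -/
theorem isCompact_setOf_logNorm_mem {n : ℕ} (J : Set (MvPolynomial (Fin n) ℂ))
    {F : Set (EuclideanSpace ℝ (Fin n))} (hF : IsCompact F) :
    IsCompact {w : Fin n → ℂ | (∀ i, w i ≠ 0) ∧ (∀ p ∈ J, eval w p = 0) ∧ logNorm w ∈ F} := by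
  obtain ⟨M, hM⟩ := hF.isBounded.exists_norm_le
  -- A bound on the logarithms keeps the coordinates away from zero as well as from infinity.
  let T : Set (Fin n → ℂ) := Set.pi univ fun _ =>
    Metric.closedBall 0 (Real.exp M) ∩ {z | Real.exp (-M) ≤ ‖z‖}
  have hT : IsCompact T := isCompact_univ_pi fun _ =>
    (isCompact_closedBall _ _).inter_right (isClosed_le continuous_const continuous_norm)
  have hT0 : ∀ w ∈ T, ∀ i, w i ≠ 0 := by
    intro w hw i
    have h1 : Real.exp (-M) ≤ ‖w i‖ := (hw i (mem_univ i)).2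
    exact norm_pos_iff.1 ((Real.exp_pos _).trans_le h1)
  have hcont : ContinuousOn logNorm T := fun w hw =>
    (continuousAt_logNorm (hT0 w hw)).continuousWithinAt
  have hclosed : IsClosed (T ∩ logNorm ⁻¹' F) :=
    hcont.preimage_isClosed_of_isClosed hT.isClosed hF.isClosed
  have hJ : IsClosed {w : Fin n → ℂ | ∀ p ∈ J, eval w p = 0} := by
    have : {w : Fin n → ℂ | ∀ p ∈ J, eval w p = 0} = ⋂ p ∈ J, {w | eval w p = 0} := by
      ext w
      simp
    rw [this]
    exact isClosed_biInter fun p _ => isClosed_eq p.continuous_eval continuous_const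
  convert (hT.of_isClosed_subset hclosed inter_subset_left).inter_right hJ using 1
  ext w
  constructor
  · rintro ⟨h0, hp, hw⟩
    refine ⟨⟨fun i _ => ?_, hw⟩, hp⟩
    have h1 : |Real.log ‖w i‖| ≤ M := (PiLp.norm_apply_le (logNorm w) i).trans (hM _ hw)
    have hpos : 0 < ‖w i‖ := norm_pos_iff.2 (h0 i)
    rw [abs_le] at h1
    refine ⟨?_, ?_⟩
    · rw [mem_closedBall_zero_iff]
      exact (Real.log_le_iff_le_exp hpos).1 h1.2
    · exact (Real.le_log_iff_exp_le hpos).1 h1.1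
  · rintro ⟨⟨hT', hw⟩, hp⟩
    exact ⟨hT0 w hT', hp, hw⟩

/-- A Laurent monomial is the quotient of two monomials. -/
theorem exists_monomials_log_norm_eq {n : ℕ} (a : Fin n → ℤ) :
    ∃ f g : MvPolynomial (Fin n) ℂ, ∀ w : Fin n → ℂ, (∀ i, w i ≠ 0) →
      eval w f ≠ 0 ∧ eval w g ≠ 0 ∧
        Real.log ‖eval w f / eval w g‖ = ∑ i, (a i : ℝ) * logNorm w i := by
  refine ⟨∏ i, X i ^ (a i).toNat, ∏ i, X i ^ (-a i).toNat, fun w hw => ?_⟩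
  have hf : eval w (∏ i, X i ^ (a i).toNat) ≠ 0 := by
    simp only [map_prod, map_pow, eval_X]
    exact Finset.prod_ne_zero_iff.2 fun i _ => pow_ne_zero _ (hw i)
  have hg : eval w (∏ i, X i ^ (-a i).toNat) ≠ 0 := by
    simp only [map_prod, map_pow, eval_X]
    exact Finset.prod_ne_zero_iff.2 fun i _ => pow_ne_zero _ (hw i)
  refine ⟨hf, hg, ?_⟩
  rw [norm_div, Real.log_div (norm_ne_zero_iff.2 hf) (norm_ne_zero_iff.2 hg)]
  simp only [map_prod, map_pow, eval_X, norm_prod, norm_pow]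
  rw [Real.log_prod fun i _ => pow_ne_zero _ (norm_ne_zero_iff.2 (hw i)),
    Real.log_prod fun i _ => pow_ne_zero _ (norm_ne_zero_iff.2 (hw i)), ← Finset.sum_sub_distrib]
  refine Finset.sum_congr rfl fun i _ => ?_
  rw [Real.log_pow, Real.log_pow, ← sub_mul]
  congr 1
  exact_mod_cast Int.toNat_sub_toNat_neg (a i)

end LogMap

/-! ### The maximum principle on a rational lens. -/

section Core

open MvPolynomial

/-- Let `w₀` be a point of a component of codimension `k` of a variety in the torus, and consider
the intersection of a ball around `c₀` that contains `Log w₀` with a rational half-space of dimension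
at least `k + 1` whose boundary contains `Log w₀`. Then the amoeba meets the spherical part of the
boundary of this intersection. -/
theorem exists_logNorm_mem_sphere_of_add_height_lt {n k s : ℕ}
    (I P₀ : Ideal (MvPolynomial (Fin n) ℂ)) [P₀.IsPrime] (hIP : I ≤ P₀) (hk : P₀.height = k)
    (hs : s + k < n) (w₀ : Fin n → ℂ)
    (hw₀ : ∀ i, w₀ i ≠ 0) (hP₀ : ∀ p ∈ P₀, eval w₀ p = 0) (a : Fin s → Fin n → ℤ) (d : Fin n → ℤ)
    (c₀ : EuclideanSpace ℝ (Fin n)) (R : ℝ) (hR : dist (logNorm w₀) c₀ ≤ R) :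
    ∃ w : Fin n → ℂ, (∀ i, w i ≠ 0) ∧ (∀ p ∈ I, eval w p = 0) ∧ dist (logNorm w) c₀ = R ∧
      (∀ j, ∑ i, (a j i : ℝ) * (logNorm w i - logNorm w₀ i) = 0) ∧
      0 ≤ ∑ i, (d i : ℝ) * (logNorm w i - logNorm w₀ i) := by
  classical
  by_contra! hno
  have hM : (RingHom.ker (eval w₀)).IsMaximal :=
    RingHom.ker_isMaximal_of_surjective _ fun z => ⟨C z, eval_C z⟩
  choose f g hfg using fun j => exists_monomials_log_norm_eq (a j)
  obtain ⟨f', g', hfg'⟩ := exists_monomials_log_norm_eq d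
  -- cut down by the binomial equations
  let e : Fin s → MvPolynomial (Fin n) ℂ :=
    fun j => f j * C (eval w₀ (g j)) - C (eval w₀ (f j)) * g j
  obtain ⟨P, hP, hP₀P, hPM, heP⟩ := MvPolynomial.exists_isPrime_lt_of_card_add_height_lt n P₀
    (RingHom.ker (eval w₀)) (fun p hp => hP₀ p hp) (Finset.univ.image e) (by
      intro q hq
      obtain ⟨j, -, rfl⟩ := Finset.mem_image.1 hq
      rw [RingHom.mem_ker, map_sub, map_mul, map_mul, eval_C, eval_C, sub_self]) (by
      rw [hk]
      have h1 : (Finset.univ.image e).card ≤ s := Finset.card_image_le.trans (by simp)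
      exact_mod_cast lt_of_le_of_lt (Nat.add_le_add_right h1 k) hs)
  have hPw₀ : ∀ p ∈ P, eval w₀ p = 0 := fun p hp => hPM.le hp
  have hconst : ∀ (f g : MvPolynomial (Fin n) ℂ) (w v : Fin n → ℂ), (∀ p ∈ P, eval v p = 0) →
      eval v g ≠ 0 → eval w g ≠ 0 → f * C (eval w g) - C (eval w f) * g ∈ P →
      eval v f / eval v g = eval w f / eval w g := by
    intro f g w v hv hvg hwg h
    have h1 := hv _ h
    rw [map_sub, map_mul, map_mul, eval_C, eval_C, sub_eq_zero] at h1
    rw [div_eq_div_iff hvg hwg, h1]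
  have hlin : ∀ (b : Fin n → ℤ) (w : Fin n → ℂ),
      ∑ i, (b i : ℝ) * (logNorm w i - logNorm w₀ i) =
        ∑ i, (b i : ℝ) * logNorm w i - ∑ i, (b i : ℝ) * logNorm w₀ i := by
    intro b w
    rw [← Finset.sum_sub_distrib]
    exact Finset.sum_congr rfl fun i _ => by ring
  have ha : ∀ w : Fin n → ℂ, (∀ i, w i ≠ 0) → (∀ p ∈ P, eval w p = 0) →
      ∀ j, ∑ i, (a j i : ℝ) * (logNorm w i - logNorm w₀ i) = 0 := by
    intro w hw hPw j
    rw [hlin, sub_eq_zero, ← (hfg j w hw).2.2, ← (hfg j w₀ hw₀).2.2,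
      hconst (f j) (g j) w₀ w hPw (hfg j w hw).2.1 (hfg j w₀ hw₀).2.1
        (heP _ (Finset.mem_image_of_mem e (Finset.mem_univ j)))]
  let lam : EuclideanSpace ℝ (Fin n) → ℝ := fun x => ∑ i, (d i : ℝ) * (x i - logNorm w₀ i)
  have hlam : Continuous lam := by fun_prop
  let F : Set (EuclideanSpace ℝ (Fin n)) := Metric.closedBall c₀ R ∩ {x | 0 ≤ lam x}
  have hF : IsCompact F :=
    (isCompact_closedBall _ _).inter_right (isClosed_le continuous_const hlam)
  let K : Set (Fin n → ℂ) :=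
    {w | (∀ i, w i ≠ 0) ∧ (∀ p ∈ (P : Set (MvPolynomial (Fin n) ℂ)), eval w p = 0) ∧
      logNorm w ∈ F}
  have hK : IsCompact K := isCompact_setOf_logNorm_mem _ hF
  have hw₀K : w₀ ∈ K := ⟨hw₀, hPw₀, hR, by
    change 0 ≤ ∑ i, (d i : ℝ) * (logNorm w₀ i - logNorm w₀ i)
    simp⟩
  have hKne : K.Nonempty := ⟨w₀, hw₀K⟩
  -- near a point of `K`, the points of the variety of `P` stay in the ball
  have hnear : ∀ w ∈ K, ∀ᶠ v in 𝓝 w, (∀ i, v i ≠ 0) ∧ dist (logNorm v) c₀ ≤ R := by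
    rintro w ⟨hw, hPw, hwF⟩
    have hlt : dist (logNorm w) c₀ < R := by
      refine lt_of_le_of_ne hwF.1 fun h => ?_
      exact absurd (show 0 ≤ lam (logNorm w) from hwF.2)
        (not_le.2 (hno w hw (fun p hp => hPw p (hP₀P (hIP hp))) h (ha w hw hPw)))
    refine (Filter.eventually_all.2 fun i => ?_).and ?_
    · exact ((continuous_apply i).tendsto w).eventually_ne (hw i)
    · have h1 := (continuousAt_logNorm hw).dist (continuousAt_const (y := c₀))
      exact (h1.eventually_lt_const hlt).mono fun v hv => hv.le
  -- the Laurent monomial with exponent `d` is constant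
  have hd : ∀ w : Fin n → ℂ, (∀ i, w i ≠ 0) → (∀ p ∈ P, eval w p = 0) → lam (logNorm w) = 0 := by
    have hcont : ContinuousOn (fun w => lam (logNorm w)) K := fun w hw =>
      (hlam.continuousAt.comp (continuousAt_logNorm hw.1)).continuousWithinAt
    -- A nearby point of the variety of `P` with larger `lam` stays in the half-space, hence in `K`;
    -- so this maximum is local on the whole variety.
    obtain ⟨w₁, hw₁, hmax⟩ := hK.exists_isMaxOn hKne hcont
    have hmem : f' * C (eval w₁ g') - C (eval w₁ f') * g' ∈ P := by
      by_contra hnot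
      obtain ⟨v, ⟨hPv, hgv, hlt⟩, hv0, hvR⟩ := ((MvPolynomial.frequently_norm_div_lt P w₁ hw₁.2.1
        f' g' (hfg' w₁ hw₁.1).2.1 hnot).and_eventually (hnear w₁ hw₁)).exists
      have h1 : lam (logNorm w₁) < lam (logNorm v) := by
        change ∑ i, (d i : ℝ) * _ < ∑ i, (d i : ℝ) * _
        rw [hlin, hlin, ← (hfg' w₁ hw₁.1).2.2, ← (hfg' v hv0).2.2]
        have := Real.log_lt_log (norm_pos_iff.2 (div_ne_zero (hfg' w₁ hw₁.1).1
          (hfg' w₁ hw₁.1).2.1)) hlt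
        linarith
      have h2 : v ∈ K := ⟨hv0, hPv, hvR, le_trans hw₁.2.2.2 h1.le⟩
      exact absurd (hmax h2) (not_le.2 h1)
    have hval : ∀ w : Fin n → ℂ, (∀ i, w i ≠ 0) → (∀ p ∈ P, eval w p = 0) →
        ∑ i, (d i : ℝ) * logNorm w i = ∑ i, (d i : ℝ) * logNorm w₁ i := by
      intro w hw hPw
      rw [← (hfg' w hw).2.2, ← (hfg' w₁ hw₁.1).2.2,
        hconst f' g' w₁ w hPw (hfg' w hw).2.1 (hfg' w₁ hw₁.1).2.1 hmem]
    intro w hw hPw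
    change ∑ i, (d i : ℝ) * _ = 0
    rw [hlin, hval w hw hPw, hval w₀ hw₀ hPw₀, sub_self]
  -- hence all coordinates are constant
  have hX : ∀ i, X i - C (w₀ i) ∈ P := by
    intro i
    -- Since `lam` vanishes on the variety, the half-space no longer restricts it, and the maximum
    -- of `‖w i‖` on `K` is again local.
    obtain ⟨w₁, hw₁, hmax⟩ := hK.exists_isMaxOn hKne
      ((continuous_apply i).norm.continuousOn (s := K))
    have hmem : X i * C (eval w₁ (1 : MvPolynomial (Fin n) ℂ)) - C (eval w₁ (X i)) * 1 ∈ P := by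
      by_contra hnot
      obtain ⟨v, ⟨hPv, -, hlt⟩, hv0, hvR⟩ := ((MvPolynomial.frequently_norm_div_lt P w₁ hw₁.2.1
        (X i) 1 (by simp) hnot).and_eventually (hnear w₁ hw₁)).exists
      have h2 : v ∈ K := ⟨hv0, hPv, hvR, (hd v hv0 hPv).ge⟩
      have h3 : ‖v i‖ ≤ ‖w₁ i‖ := hmax h2
      simp only [eval_X, map_one, div_one] at hlt
      exact absurd h3 (not_le.2 hlt)
    simp only [map_one, mul_one, eval_X] at hmem
    have h4 := hPw₀ _ hmem
    rw [map_sub, eval_X, eval_C, sub_eq_zero] at h4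
    rwa [h4]
  -- Modulo `P` every polynomial equals its value at `w₀`, so `P` contains the maximal ideal of
  -- `w₀`.
  refine absurd hPM (not_lt_of_ge fun p hp => ?_)
  have : Ideal.Quotient.mk P = ((Ideal.Quotient.mk P).comp C).comp (eval w₀) := by
    apply MvPolynomial.ringHom_ext
    · intro z
      simp
    · intro i
      rw [RingHom.comp_apply, RingHom.comp_apply, eval_X, Ideal.Quotient.eq]
      exact hX i
  rw [← Ideal.Quotient.eq_zero_iff_mem, this, RingHom.comp_apply,
    show eval w₀ p = 0 from hp, map_zero]

end Core

/-! ### Rational approximation of half-planes. -/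

section Convexity

/-- Up to a positive factor, vectors of `ℝⁿ` are approximated by integral vectors. -/
theorem exists_int_abs_sum_sub_inner_le {n : ℕ} {κ : ℝ} (hκ : 0 < κ) : ∃ D : ℝ, 0 < D ∧
    ∀ b : EuclideanSpace ℝ (Fin n), ∃ a : Fin n → ℤ, ∀ x : EuclideanSpace ℝ (Fin n),
      |∑ i, (a i : ℝ) * x i - D * inner ℝ b x| ≤ D * (κ * ‖x‖) := by
  -- Rounding costs at most `n * ‖x‖`, and this scale makes the allowance `(n + 1) * ‖x‖`; the extra
  -- one keeps `D` positive when `n = 0`.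
  refine ⟨(n + 1) / κ, by positivity, fun b => ⟨fun i => round ((n + 1) / κ * b i), fun x => ?_⟩⟩
  have h1 : ∑ i, (round ((n + 1) / κ * b i) : ℝ) * x i - (n + 1) / κ * inner ℝ b x =
      ∑ i, ((round ((n + 1) / κ * b i) : ℝ) - (n + 1) / κ * b i) * x i := by
    simp only [PiLp.inner_apply, RCLike.inner_apply, conj_trivial, Finset.mul_sum,
      ← Finset.sum_sub_distrib]
    exact Finset.sum_congr rfl fun i _ => by ring
  rw [h1]
  calc |∑ i, ((round ((n + 1) / κ * b i) : ℝ) - (n + 1) / κ * b i) * x i|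
      ≤ ∑ i : Fin n, |((round ((n + 1) / κ * b i) : ℝ) - (n + 1) / κ * b i) * x i| :=
        Finset.abs_sum_le_sum_abs _ _
    _ ≤ ∑ i : Fin n, ‖x‖ := by
        refine Finset.sum_le_sum fun i _ => ?_
        rw [abs_mul]
        have h2 : |(round ((n + 1) / κ * b i) : ℝ) - (n + 1) / κ * b i| ≤ 1 := by
          rw [abs_sub_comm]
          exact (abs_sub_round _).trans (by norm_num)
        have h3 : |x i| ≤ ‖x‖ := PiLp.norm_apply_le x i
        calc _ ≤ 1 * ‖x‖ := by gcongr
          _ = ‖x‖ := one_mul _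
    _ = n * ‖x‖ := by simp
    _ ≤ (n + 1) / κ * (κ * ‖x‖) := by
        rw [← mul_assoc, div_mul_cancel₀ _ hκ.ne']
        gcongr
        linarith

/-- If a compact set `C` misses a half-plane given by equations `⟪b j, x⟫ = 0` and an inequality
`0 ≤ ⟪v, x⟫`, then it misses a half-plane with integral coefficients. -/
theorem exists_int_forall_of_isCompact {n : ℕ} {ι : Type*} [Fintype ι]
    {C : Set (EuclideanSpace ℝ (Fin n))} (hC : IsCompact C) (b : ι → EuclideanSpace ℝ (Fin n))
    (v : EuclideanSpace ℝ (Fin n))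
    (h : ∀ x ∈ C, (∀ j, inner ℝ (b j) x = 0) → ¬ 0 ≤ inner ℝ v x) :
    ∃ (a : ι → Fin n → ℤ) (d : Fin n → ℤ), ∀ x ∈ C, (∀ j, ∑ i, (a j i : ℝ) * x i = 0) →
      ¬ 0 ≤ ∑ i, (d i : ℝ) * x i := by
  -- `Φ` measures the violation of the conditions; by compactness it is bounded below on `C` by some
  -- `m > 0`.
  let Φ : EuclideanSpace ℝ (Fin n) → ℝ := fun x =>
    ∑ j, |inner ℝ (b j) x| + max 0 (-inner ℝ v x)
  have hΦ : Continuous Φ := by fun_prop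
  have hΦpos : ∀ x ∈ C, 0 < Φ x := by
    intro x hx
    have h1 : 0 ≤ ∑ j, |inner ℝ (b j) x| := Finset.sum_nonneg fun j _ => abs_nonneg _
    by_contra hle
    have h2 : 0 ≤ max 0 (-inner ℝ v x) := le_max_left _ _
    have h3 : Φ x = ∑ j, |inner ℝ (b j) x| + max 0 (-inner ℝ v x) := rfl
    refine h x hx (fun j => ?_) ?_
    · have h4 : ∑ j, |inner ℝ (b j) x| = 0 := by linarith
      exact abs_eq_zero.1 ((Finset.sum_eq_zero_iff_of_nonneg fun j _ => abs_nonneg _).1 h4 j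
        (Finset.mem_univ j))
    · have h4 := le_max_right 0 (-inner ℝ v x)
      linarith
  obtain ⟨m, hm, hmC⟩ : ∃ m > 0, ∀ x ∈ C, m ≤ Φ x := by
    rcases C.eq_empty_or_nonempty with rfl | hne
    · exact ⟨1, one_pos, fun x hx => absurd hx (notMem_empty x)⟩
    · obtain ⟨x, hx, hmin⟩ := hC.exists_isMinOn hne hΦ.continuousOn
      exact ⟨Φ x, hΦpos x hx, fun y hy => hmin hy⟩
  obtain ⟨B, hB⟩ := hC.isBounded.exists_norm_le
  -- Each of the `card ι + 1` terms of `Φ` would then be at most `m / (card ι + 2)`, with sum below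
  -- `m`.
  set κ := m / ((Fintype.card ι + 2) * (|B| + 1)) with hκ_def
  have hκ : 0 < κ := by positivity
  obtain ⟨D, hD, hDa⟩ := exists_int_abs_sum_sub_inner_le (n := n) hκ
  choose A hA using hDa
  refine ⟨fun j => A (b j), A v, fun x hx hj hv => ?_⟩
  have hxB : κ * ‖x‖ ≤ m / (Fintype.card ι + 2) := by
    have h1 : ‖x‖ ≤ |B| + 1 := by linarith [hB x hx, le_abs_self B]
    calc κ * ‖x‖ ≤ κ * (|B| + 1) := by gcongr
      _ = m / (Fintype.card ι + 2) := by
        rw [hκ_def]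
        field_simp
  have h1 : ∀ j, |inner ℝ (b j) x| ≤ m / (Fintype.card ι + 2) := by
    intro j
    refine le_trans ?_ hxB
    have h2 := hA (b j) x
    rw [hj j, zero_sub, abs_neg, abs_mul, abs_of_pos hD] at h2
    exact le_of_mul_le_mul_left h2 hD
  have h2 : max 0 (-inner ℝ v x) ≤ m / (Fintype.card ι + 2) := by
    refine max_le (by positivity) (le_trans ?_ hxB)
    have h3 := (abs_le.1 (hA v x)).2
    refine le_of_mul_le_mul_left (a := D) ?_ hD
    linarith
  have h3 : Φ x ≤ Fintype.card ι * (m / (Fintype.card ι + 2)) + m / (Fintype.card ι + 2) := by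
    refine add_le_add ?_ h2
    refine (Finset.sum_le_card_nsmul _ _ _ fun j _ => h1 j).trans ?_
    simp
  have h4 : Fintype.card ι * (m / (Fintype.card ι + 2)) + m / (Fintype.card ι + 2) < m := by
    rw [← add_one_mul, ← mul_div_assoc, div_lt_iff₀ (by positivity), mul_comm]
    gcongr
    linarith
  exact absurd (hmC x hx) (not_le.2 (h3.trans_lt h4))

end Convexity

/-! ### From a supporting cap to a lens. -/

namespace Amoeba

/-- A supporting cap of a set `A` yields a sphere and a half-space of dimension `k + 1`, bounding
a lens around a point of `A`, such that `A` misses the spherical part of the boundary. -/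
theorem IsSupportingCap.exists_lens {n k : ℕ} {A D : Set (EuclideanSpace ℝ (Fin n))}
    (h : IsSupportingCap k A D) :
    ∃ x₀ ∈ A, ∃ (s : ℕ) (b : Fin s → EuclideanSpace ℝ (Fin n)) (v c₀ : EuclideanSpace ℝ (Fin n))
      (R : ℝ), s + k < n ∧ dist x₀ c₀ ≤ R ∧
        ∀ x ∈ A, dist x c₀ = R → (∀ j, inner ℝ (b j) (x - x₀) = 0) →
          ¬ 0 ≤ inner ℝ v (x - x₀) := by
  obtain ⟨⟨L, hL, c, hcL, δ, hδ, rfl⟩, ⟨x₀, hx₀D, hx₀A⟩, hcomp, v, hv⟩ := h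
  set D := Metric.ball c δ ∩ (L : Set (EuclideanSpace ℝ (Fin n))) with hD
  set U := L.direction with hU
  obtain ⟨t₁, ht₁, hdisj⟩ : ∃ t₁ > 0, ∀ t ∈ Ioo (0 : ℝ) t₁, Disjoint ((t • v) +ᵥ D) A :=
    (mem_nhdsGT_iff_exists_Ioo_subset).1 hv
  have hnot : ∀ t, 0 < t → t < t₁ → ∀ y ∈ D, y + t • v ∉ A := by
    intro t h0 h1 y hy hyA
    refine Set.disjoint_left.1 (hdisj t ⟨h0, h1⟩) ?_ hyA
    exact ⟨y, hy, by simp [add_comm]⟩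
  -- the cap is contained in a smaller disk
  obtain ⟨r, hr0, hrδ, hr⟩ : ∃ r, 0 < r ∧ r < δ ∧ ∀ y ∈ D ∩ A, dist y c < r := by
    obtain ⟨y, hy, hmax⟩ := hcomp.exists_isMaxOn ⟨x₀, hx₀D, hx₀A⟩
      (continuous_id.dist (continuous_const (y := c))).continuousOn
    have hyδ : dist y c < δ := hy.1.1
    refine ⟨(dist y c + δ) / 2, by positivity, by linarith, fun z hz => ?_⟩
    have : dist z c ≤ dist y c := hmax hz
    linarith
  have hdirx₀ : x₀ - c ∈ U := AffineSubspace.vsub_mem_direction hx₀D.2 hcL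
  -- Otherwise `x₀ - t • v` lies in the disk for small `t`, and its translate by `t • v` is the
  -- amoeba point `x₀`.
  have hvU : v ∉ U := by
    intro hvU
    have hlim : Tendsto (fun t : ℝ => x₀ - t • v) (𝓝[>] 0) (𝓝 x₀) := by
      have : Continuous fun t : ℝ => x₀ - t • v := by fun_prop
      have h1 := (this.tendsto 0).mono_left (nhdsWithin_le_nhds (s := Ioi 0))
      simpa using h1
    have h2 : ∀ᶠ t : ℝ in 𝓝[>] 0, x₀ - t • v ∈ Metric.ball c δ :=
      hlim.eventually (Metric.isOpen_ball.mem_nhds hx₀D.1)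
    obtain ⟨t, ht, h0, h1⟩ := (h2.and (Ioo_mem_nhdsGT ht₁)).exists
    refine hnot t h0 h1 (x₀ - t • v) ⟨ht, ?_⟩ (by simpa using hx₀A)
    have := AffineSubspace.vadd_mem_of_mem_direction (U.neg_mem (U.smul_mem t hvU)) hx₀D.2
    simpa [sub_eq_neg_add] using this
  -- split `v` into its components
  set u := U.starProjection v with hu
  have huU : u ∈ U := U.starProjection_apply_mem v
  set v' := v - u with hv'
  have hv'U : ∀ y ∈ U, inner ℝ y v' = 0 := fun y hy =>
    (Submodule.mem_orthogonal U v').1 (U.sub_starProjection_mem_orthogonal v) y hy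
  have hv'0 : v' ≠ 0 := fun h0 => hvU (by rw [sub_eq_zero.1 h0]; exact huU)
  have hv'n : 0 < ‖v'‖ := norm_pos_iff.2 hv'0
  set T := U ⊔ Submodule.span ℝ {v'} with hT
  have hUT : U < T := by
    refine lt_of_le_of_ne le_sup_left fun hUT => hvU ?_
    have h1 : v' ∈ U := by
      rw [hUT]
      exact Submodule.mem_sup_right (Submodule.mem_span_singleton_self v')
    have h2 : v = v' + u := by rw [hv', sub_add_cancel]
    rw [h2]
    exact U.add_mem h1 huU
  have hdim : Module.finrank ℝ Tᗮ + k < n := by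
    have h1 := Submodule.finrank_lt_finrank_of_lt hUT
    have h2 := Submodule.finrank_add_finrank_orthogonal T
    rw [finrank_euclideanSpace_fin] at h2
    rw [hL] at h1
    omega
  let b := stdOrthonormalBasis ℝ Tᗮ
  have hb : ∀ x, (∀ j, inner ℝ (b j : EuclideanSpace ℝ (Fin n)) x = 0) → x ∈ T := by
    intro x hx
    rw [← Submodule.orthogonal_orthogonal T, Submodule.mem_orthogonal]
    intro y hy
    have h1 : (⟨y, hy⟩ : Tᗮ) = ∑ j, inner ℝ (b j) ⟨y, hy⟩ • b j := (b.sum_repr' ⟨y, hy⟩).symm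
    have h2 : y = ∑ j, inner ℝ (b j) (⟨y, hy⟩ : Tᗮ) • (b j : EuclideanSpace ℝ (Fin n)) := by
      have := congrArg Subtype.val h1
      simpa using this
    rw [h2, sum_inner]
    exact Finset.sum_eq_zero fun j _ => by rw [real_inner_smul_left, hx j, mul_zero]
  -- choose the sphere
  obtain ⟨t₀, ht₀, ht₀₁, ht₀δ⟩ : ∃ t₀, 0 < t₀ ∧ t₀ < t₁ ∧ r + t₀ * ‖u‖ < δ := by
    have hlim : Tendsto (fun t : ℝ => r + t * ‖u‖) (𝓝[>] 0) (𝓝 r) := by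
      have : Continuous fun t : ℝ => r + t * ‖u‖ := by fun_prop
      have h1 := (this.tendsto 0).mono_left (nhdsWithin_le_nhds (s := Ioi 0))
      simpa using h1
    obtain ⟨t, ht, h0, h1⟩ := ((hlim.eventually_lt_const hrδ).and (Ioo_mem_nhdsGT ht₁)).exists
    exact ⟨t, h0, h1, ht⟩
  -- The sphere about `c - N • v'` meets `L` in the sphere of radius `r` about `c`. At height `t ≥
  -- 0` its points satisfy `2 * t * N * ‖v'‖ ^ 2 ≤ r ^ 2`, so this `N` keeps the lens below height
  -- `t₀`.
  set N := (r ^ 2 + 1) / (2 * t₀ * ‖v'‖ ^ 2) with hN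
  have hN0 : 0 < N := by positivity
  have hNt : 2 * t₀ * N * ‖v'‖ ^ 2 = r ^ 2 + 1 := by
    rw [hN]
    field_simp
  have hpyth : ∀ y ∈ U, ∀ t : ℝ, dist (c + y + t • v') (c - N • v') ^ 2 =
      ‖y‖ ^ 2 + (t + N) ^ 2 * ‖v'‖ ^ 2 := by
    intro y hy t
    have h1 : c + y + t • v' - (c - N • v') = y + (t + N) • v' := by
      rw [add_smul]
      abel
    rw [dist_eq_norm, h1, norm_add_sq_real, real_inner_smul_right, hv'U y hy, norm_smul, mul_pow,
      Real.norm_eq_abs, sq_abs]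
    ring
  have hR0 : 0 ≤ r ^ 2 + N ^ 2 * ‖v'‖ ^ 2 := by positivity
  refine ⟨x₀, hx₀A, Module.finrank ℝ Tᗮ, fun j => b j, v', c - N • v',
    √(r ^ 2 + N ^ 2 * ‖v'‖ ^ 2), hdim, ?_, ?_⟩
  · rw [Real.le_sqrt dist_nonneg hR0]
    have h1 := hpyth (x₀ - c) hdirx₀ 0
    rw [zero_smul, add_zero, add_sub_cancel, zero_add] at h1
    rw [h1]
    have h2 : ‖x₀ - c‖ < r := by
      rw [← dist_eq_norm]
      exact hr x₀ ⟨hx₀D, hx₀A⟩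
    gcongr
  · intro x hxA hxR hxb hxv
    obtain ⟨y, hy, z, hz, hyz⟩ := Submodule.mem_sup.1 (hb _ hxb)
    obtain ⟨t, rfl⟩ := Submodule.mem_span_singleton.1 hz
    have ht : 0 ≤ t := by
      rw [← hyz, inner_add_right, real_inner_comm, hv'U y hy, zero_add, real_inner_smul_right,
        real_inner_self_eq_norm_sq] at hxv
      exact nonneg_of_mul_nonneg_left hxv (by positivity)
    have hy' : y + (x₀ - c) ∈ U := U.add_mem hy hdirx₀
    set y' := y + (x₀ - c) with hy'_def
    have hx : x = c + y' + t • v' := by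
      have h1 : x = x₀ + (y + t • v') := by rw [hyz, add_sub_cancel]
      rw [h1, hy'_def]
      abel
    have hsq : ‖y'‖ ^ 2 + (t + N) ^ 2 * ‖v'‖ ^ 2 = r ^ 2 + N ^ 2 * ‖v'‖ ^ 2 := by
      rw [← hpyth y' hy' t, ← hx, hxR, Real.sq_sqrt hR0]
    have hsum : ‖y'‖ ^ 2 + t ^ 2 * ‖v'‖ ^ 2 + 2 * t * N * ‖v'‖ ^ 2 = r ^ 2 := by linarith
    have hp1 : 0 ≤ t ^ 2 * ‖v'‖ ^ 2 := by positivity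
    have hp2 : 0 ≤ 2 * t * N * ‖v'‖ ^ 2 := by positivity
    have hy'r : ‖y'‖ ≤ r := by
      refine abs_le_of_sq_le_sq' ?_ hr0.le |>.2
      linarith
    have htt : t ≤ t₀ := by
      by_contra hlt
      push Not at hlt
      have h1 : 2 * t₀ * N * ‖v'‖ ^ 2 ≤ 2 * t * N * ‖v'‖ ^ 2 := by gcongr
      have h2 := sq_nonneg ‖y'‖
      linarith
    rcases ht.eq_or_lt with h0 | h0
    · -- the bounding sphere of the disk
      rw [← h0] at hx hsum
      rw [zero_smul, add_zero] at hx
      have hy'eq : ‖y'‖ = r := by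
        have h1 : ‖y'‖ ^ 2 = r ^ 2 := by
          rw [← hsum]
          ring
        exact (sq_eq_sq₀ (norm_nonneg _) hr0.le).1 h1
      have hxc : dist x c = r := by rw [hx, dist_eq_norm, add_sub_cancel_left, hy'eq]
      refine absurd (hr x ⟨⟨?_, ?_⟩, hxA⟩) (not_lt.2 hxc.ge)
      · rw [Metric.mem_ball, hxc]
        exact hrδ
      · rw [hx, add_comm]
        exact AffineSubspace.vadd_mem_of_mem_direction hy' hcL
    · -- the translates of the disk
      have hyD : c + (y' - t • u) ∈ D := by
        refine ⟨?_, ?_⟩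
        · rw [Metric.mem_ball, dist_eq_norm, add_sub_cancel_left]
          calc ‖y' - t • u‖ ≤ ‖y'‖ + ‖t • u‖ := norm_sub_le _ _
            _ = ‖y'‖ + t * ‖u‖ := by rw [norm_smul, Real.norm_eq_abs, abs_of_pos h0]
            _ ≤ r + t₀ * ‖u‖ := by gcongr
            _ < δ := ht₀δ
        · rw [add_comm]
          exact AffineSubspace.vadd_mem_of_mem_direction
            (U.sub_mem hy' (U.smul_mem t huU)) hcL
      refine hnot t h0 (htt.trans_lt ht₀₁) _ hyD ?_
      have h1 : c + (y' - t • u) + t • v = x := by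
        rw [hx, hv', smul_sub]
        abel
      rwa [h1]

end Amoeba

/-! ### Conclusion. -/

theorem mainTheorem1 (n k : ℕ) (V : Set (Fin n → ℂˣ)) (hV : Amoeba.IsAlgebraicSet V)
    (hk : Amoeba.HasCodim V k) :
    ¬ ∃ D : Set (EuclideanSpace ℝ (Fin n)), Amoeba.IsSupportingCap k (Amoeba.amoeba V) D := by
  rintro ⟨D, hD⟩
  obtain ⟨x₀, ⟨z₀, hz₀, rfl⟩, s, b, v, c₀, R, hs, hR, hlens⟩ := hD.exists_lens
  set I := MvPolynomial.vanishingIdeal ℂ (Amoeba.torusIncl '' V) with hI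
  -- points of the torus annihilated by `I` belong to `V`
  have hmem : ∀ w : Fin n → ℂ, (∀ i, w i ≠ 0) → (∀ p ∈ I, MvPolynomial.eval w p = 0) →
      logNorm w ∈ Amoeba.amoeba V := by
    intro w hw hIw
    refine ⟨fun i => Units.mk0 (w i) (hw i), ?_, rfl⟩
    obtain ⟨S, hS⟩ := hV
    have hSI : ∀ p ∈ S, p ∈ I := by
      intro p hp
      rw [hI, MvPolynomial.mem_vanishingIdeal_iff]
      rintro _ ⟨z, hz, rfl⟩
      rw [hS] at hz
      exact hz p hp
    rw [hS]
    exact fun p hp => hIw p (hSI p hp)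
  let w₀ : Fin n → ℂ := Amoeba.torusIncl z₀
  have hw₀ : ∀ i, w₀ i ≠ 0 := fun i => (z₀ i).ne_zero
  have hlog : logNorm w₀ = Amoeba.Log z₀ := rfl
  have hIw₀ : I ≤ RingHom.ker (MvPolynomial.eval w₀) := by
    intro p hp
    rw [hI, MvPolynomial.mem_vanishingIdeal_iff] at hp
    exact hp w₀ ⟨z₀, hz₀, rfl⟩
  have hprime : (RingHom.ker (MvPolynomial.eval w₀)).IsPrime := RingHom.ker_isPrime _
  -- This is a component of `V` through `w₀`; its height is `k` by `hk`.
  obtain ⟨P₀, hP₀, hP₀w₀⟩ := Ideal.exists_minimalPrimes_le hIw₀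
  have hP₀p : P₀.IsPrime := hP₀.1.1
  -- approximate the lens by a rational one
  let E : Set (EuclideanSpace ℝ (Fin n)) :=
    (fun x => x - Amoeba.Log z₀) '' (logNorm '' {w : Fin n → ℂ | (∀ i, w i ≠ 0) ∧
      (∀ p ∈ (I : Set (MvPolynomial (Fin n) ℂ)), MvPolynomial.eval w p = 0) ∧
        logNorm w ∈ Metric.sphere c₀ R})
  have hE : IsCompact E :=
    ((isCompact_setOf_logNorm_mem _ (isCompact_sphere c₀ R)).image_of_continuousOn
      fun w hw => (continuousAt_logNorm hw.1).continuousWithinAt).image (by fun_prop)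
  obtain ⟨a, d, had⟩ := exists_int_forall_of_isCompact hE b v <| by
    rintro _ ⟨_, ⟨w, ⟨hw, hwI, hwR⟩, rfl⟩, rfl⟩
    exact hlens _ (hmem w hw hwI) hwR
  obtain ⟨w, hw, hwI, hwR, hwa, hwd⟩ := exists_logNorm_mem_sphere_of_add_height_lt I P₀ hP₀.1.2
    (hk P₀ hP₀) hs w₀ hw₀ (fun p hp => hP₀w₀ hp) a d c₀ R hR
  exact had (logNorm w - Amoeba.Log z₀) ⟨_, ⟨w, ⟨hw, hwI, hwR⟩, rfl⟩, rfl⟩ hwa hwd
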